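/- Let $F$ be a field; algebras are unital associative $F$-algebras. An algebra $A$ is a *unital locally matrix algebra* if every finite subset of $A$ lies in a subalgebra containing $1_A$ and isomorphic to $M_n(F)$ for some $n\ge 1$. A *Steinitz number* is a formal product $\prod_p p^{r_p}$ over all primes $p$, with $r_p\in\{0,1,2,\dots\}\cup\{\infty\}$; Steinitz numbers are multiplied by adding exponents, and positive integers are Steinitz numbers. A Steinitz number is *locally finite* if all its $r_p$ are finite. The Steinitz number $\mathbf{st}(A)$ of a unital locally matrix algebra $A$ is the least common multiple of all $n\ge 1$ such that $A$ has a subalgebra containing $1_A$ and isomorphic to $M_n(F)$. Steinitz numbers $s_1,s_2$ are *rationally connected* if $s_2=q\cdot s_1$ for some rational $q=m/n>0$ (with positive integers $m,n$), i.e. $n\cdot s_2=m\cdot s_1$. Algebras $A,B$ are *Morita equivalent* if their categories of left modules are equivalent, and *$F$-linearly Morita equivalent* if there is an $F$-linear such equivalence. Two algebras are *universally equivalent* if they satisfy the same universal sentences in the first-order language of unital $F$-algebras (with a unary operation for each scalar in $F$). 1. If unital locally matrix algebras $A,B$ are Morita equivalent, then $\mathbf{st}(A)$ and $\mathbf{st}(B)$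 are rationally connected. 2. If $A,B$ are unital locally matrix algebras with $\dim_F A\le\aleph_0$ and $\dim_F B\le\aleph_0$, then each of "$A,B$ are Morita equivalent" and "$A,B$ are $F$-linearly Morita equivalent" holds if and only if $\mathbf{st}(A)$ and $\mathbf{st}(B)$ are rationally connected. 3. For every Steinitz number $s$ that is not locally finite and every cardinal $\alpha>\aleph_0$ there are unital locally matrix algebras $A,B$ with $\dim_F A=\dim_F B=\alpha$ and $\mathbf{st}(A)=\mathbf{st}(B)=s$ that are not Morita equivalent. 4. For a unital locally matrix algebra $A$, let its Morita class consist of all algebras that are $F$-linearly Morita equivalent to $A$, together with all unital locally matrix algebras that are Morita equivalent to $A$. If $\dim_F A\le\aleph_0$, then the Morita class of $A$ is at most countable up to isomorphism of algebras. For $A$ of arbitrary dimension, the Morita class of $A$ is at most countable up to universal equivalence. -/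

import Mathlib

universe u

open CategoryTheory

/-- A Steinitz (supernatural) number `∏ p ^ (r p)`, given by its exponents
`r p ∈ {0, 1, 2, …, ∞}` at all primes `p`. -/
@[ext]
structure SteinitzNumber where
  /-- The exponent at each prime. -/
  exponent : Nat.Primes → ℕ∞

namespace SteinitzNumber

/-- The product of Steinitz numbers: exponents are added. -/
instance : Mul SteinitzNumber where
  mul s t := ⟨fun p => s.exponent p + t.exponent p⟩

/-- A positive integer, seen as a Steinitz number. -/
def ofPNat (n : ℕ+) : SteinitzNumber :=
  ⟨fun p => ((n : ℕ).factorization p : ℕ∞)⟩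

/-- The least common multiple of a set of positive integers: the exponent at `p` is the supremum
of the exponents of `p` in the members of the set. -/
noncomputable def lcm (S : Set ℕ+) : SteinitzNumber :=
  ⟨fun p => ⨆ n ∈ S, ((n : ℕ).factorization p : ℕ∞)⟩

/-- A Steinitz number is locally finite if all its exponents are finite. -/
def IsLocallyFinite (s : SteinitzNumber) : Prop :=
  ∀ p, s.exponent p ≠ ⊤

/-- `t = q · s` for a positive rational number `q = m / n`. As division is not available
for Steinitz numbers, this is written as `n · t = m · s`. -/
def IsRatMul (q : ℚ) (s t : SteinitzNumber) : Prop :=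
  ∃ m n : ℕ+, q = (m : ℚ) / (n : ℚ) ∧ ofPNat n * t = ofPNat m * s

/-- `s` and `t` are rationally connected: `t = q · s` for some rational number `q`. -/
def RationallyConnected (s t : SteinitzNumber) : Prop :=
  ∃ q : ℚ, IsRatMul q s t

end SteinitzNumber

/-- `A` is a unital locally matrix algebra over `F`: every finite set of elements lies in a
subalgebra (containing `1`) isomorphic to a matrix algebra `Mₙ(F)`, `n ≥ 1`. -/
def IsLocallyMatrix (F A : Type u) [Field F] [Ring A] [Algebra F A] : Prop :=
  ∀ S : Finset A, ∃ B : Subalgebra F A, (S : Set A) ⊆ B ∧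
    ∃ n : ℕ+, Nonempty (B ≃ₐ[F] Matrix (Fin n) (Fin n) F)

/-- The set `D(A)` of all `n ≥ 1` such that `A` has a unital subalgebra isomorphic to `Mₙ(F)`. -/
def matrixDegrees (F A : Type u) [Field F] [Ring A] [Algebra F A] : Set ℕ+ :=
  {n | ∃ B : Subalgebra F A, Nonempty (B ≃ₐ[F] Matrix (Fin n) (Fin n) F)}

/-- The Steinitz number `st(A)`, the least common multiple of `D(A)`. -/
noncomputable def steinitz (F A : Type u) [Field F] [Ring A] [Algebra F A] : SteinitzNumber :=
  SteinitzNumber.lcm (matrixDegrees F A)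

/-- The categories of left `A`-modules and of left `B`-modules are equivalent, as categories.
(`IsMoritaEquivalent F A B` of Mathlib asks for an `F`-linear equivalence.) -/
def MoritaEquivalent (A B : Type u) [Ring A] [Ring B] : Prop :=
  Nonempty (ModuleCat.{u} A ≌ ModuleCat.{u} B)

/-- The operation symbols of unital `F`-algebras; each scalar is a unary operation. -/
inductive AlgebraFunctions (F : Type u) : ℕ → Type u
  | zero : AlgebraFunctions F 0
  | one : AlgebraFunctions F 0
  | neg : AlgebraFunctions F 1
  | smul (c : F) : AlgebraFunctions F 1
  | add : AlgebraFunctions F 2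
  | mul : AlgebraFunctions F 2

/-- The signature of unital `F`-algebras; equality is the only relation. -/
def algebraLanguage (F : Type u) : FirstOrder.Language.{u, 0} :=
  ⟨AlgebraFunctions F, fun _ => Empty⟩

/-- A unital `F`-algebra as an algebraic system. -/
instance algebraStructure (F A : Type u) [Field F] [Ring A] [Algebra F A] :
    (algebraLanguage F).Structure A where
  funMap {_} f v :=
    match f, v with
    | .zero, _ => 0
    | .one, _ => 1
    | .neg, v => - v 0
    | .smul c, v => c • v 0
    | .add, v => v 0 + v 1
    | .mul, v => v 0 * v 1
  RelMap {_} r := nomatch r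

/-- `A` and `B` satisfy the same universal sentences in the signature of unital `F`-algebras. -/
def UniversallyEquivalent (F A B : Type u) [Field F] [Ring A] [Algebra F A]
    [Ring B] [Algebra F B] : Prop :=
  ∀ φ : (algebraLanguage F).Sentence,
    FirstOrder.Language.BoundedFormula.IsUniversal φ →
      (FirstOrder.Language.Sentence.Realize A φ ↔ FirstOrder.Language.Sentence.Realize B φ)

/-- The `F`-algebra `B` belongs to the Morita equivalence class of the locally matrix algebra `A`:
either the module categories are `F`-linearly equivalent, or `B` is a locally matrix algebra too
and the module categories are equivalent as categories. -/
def InMoritaClass (F A B : Type u) [Field F] [Ring A] [Algebra F A]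
    [Ring B] [Algebra F B] : Prop :=
  IsMoritaEquivalent F A B ∨ (IsLocallyMatrix F B ∧ MoritaEquivalent A B)

/-!
A corner of a ring `R` is a ring `e R e` with `e` idempotent. An equivalence of the module
categories over `A` and `B` identifies `B` with a corner of some `Mₖ(A)` (`exists_cornerEmbedding`).
If `A` is a locally matrix algebra, `e` lies in a matrix subalgebra of `Mₖ(A)` of some degree `N`
and has a rank `r` there; homomorphisms of matrix algebras preserve the ratio of rank and degree, so
`N · st(B) = r · st(Mₖ(A)) = r · k · st(A)` (`IsCornerEmbedding.steinitz_exponent`). An equivalence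
that is not linear yields the same for a second `F`-algebra structure on `B`, and the Steinitz
number does not see the difference, because it can be read off from systems of matrix units
(`MoritaEquivalent.invariants`).

Conversely, in countable dimension the Steinitz number determines the algebra
(`IsLocallyMatrix.nonempty_algEquiv`, Glimm's theorem, by back-and-forth and the Skolem–Noether
theorem). If `n · st(B) = m · st(A)`, then `Mₙ(B)` and `Mₘ(A)` have the same Steinitz number, hence
are isomorphic, and `A` and `B` are Morita equivalent. In any dimension the Steinitz number
determines the matrix subalgebras up to isomorphism, and with them the universal theory
(`IsLocallyMatrix.universallyEquivalent`). As there are only countably many rational numbers, the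
Morita class of `A` realizes countably many Steinitz numbers, which gives the two countability
statements.

In uncountable dimension the Morita invariant that separates algebras of equal dimension and
Steinitz number is `CountableBicentralizers`: whether the bicentralizer of every countable subset is
spanned by countably many elements over the center. The algebras consist of operators on the
functions on an abelian group `G`. An idempotent endomorphism `π` of `G` with finite image splits
`G` as a product of the image and the kernel, so that the matrices over the image act on the
functions, and a directed family of such retractions yields a locally matrix algebra
(`unionAlgebra`). For the retractions of a product of cyclic groups onto finite subproducts the
result is a tensor product of matrix algebras, in which the bicentralizer of a set involves only the
coordinates that occur in the set (`countableBicentralizers_coord`). For the second algebra, take an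
additional factor `V`, a vector space of countable dimension over `ℤ/p`, and an uncountable
separating space `W` of functionals, and admit the retractions of `V` that are given by finitely
many elements of `W`. A countable subset of `W` already separates the points of `V`, so the
bicentralizer of the corresponding multiplication operators contains all multiplication operators
defined by elements of `W`, which no countable set spans (`not_countableBicentralizers`). If `p` has
exponent `∞` in `s`, the additional factor does not change the Steinitz number.
-/

/-! ### Idempotents and homomorphisms of matrix algebras -/

section MatrixIdempotents

variable {F : Type*} [Field F] {n m : Type*} [Fintype n] [DecidableEq n] [Fintype m]
  [DecidableEq m]

theorem Matrix.rank_mul_of_leftInverse {F : Type*} [Field F] {n m : Type*} [Fintype n] [Fintype m]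
    [DecidableEq m] (P : Matrix n m F) (Q : Matrix m n F) (h : Q * P = 1) :
    (P * Q).rank = Fintype.card m := by
  apply le_antisymm
  · exact (Matrix.rank_mul_le_left P Q).trans (Matrix.rank_le_card_width P)
  · have : Q * (P * Q) * P = 1 := by rw [← Matrix.mul_assoc, h, Matrix.one_mul, h]
    calc Fintype.card m = (1 : Matrix m m F).rank := Matrix.rank_one.symm
      _ = (Q * (P * Q) * P).rank := by rw [this]
      _ ≤ (Q * (P * Q)).rank := Matrix.rank_mul_le_left _ _
      _ ≤ (P * Q).rank := Matrix.rank_mul_le_right _ _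

/-- The rank factorization of an idempotent matrix. -/
theorem Matrix.exists_factor_of_idempotent (e : Matrix n n F) (he : e * e = e) :
    ∃ (r : ℕ) (P : Matrix n (Fin r) F) (Q : Matrix (Fin r) n F),
      P * Q = e ∧ Q * P = 1 ∧ e.rank = r := by
  let f := Matrix.toLin' e
  let r := Module.finrank F (LinearMap.range f)
  let b := (LinearEquiv.ofFinrankEq (Fin r → F) (LinearMap.range f)
    (Module.finrank_fin_fun F))
  have h1 : LinearMap.toMatrix' ((LinearMap.range f).subtype ∘ₗ b.toLinearMap) *
      LinearMap.toMatrix' (b.symm.toLinearMap ∘ₗ f.rangeRestrict) = e := by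
    rw [← LinearMap.toMatrix'_comp]
    have : ((LinearMap.range f).subtype ∘ₗ b.toLinearMap) ∘ₗ b.symm.toLinearMap ∘ₗ f.rangeRestrict
        = f := by
      refine LinearMap.ext fun x => ?_
      simp
    rw [this]; exact LinearMap.toMatrix'_toLin' e
  have h2 : LinearMap.toMatrix' (b.symm.toLinearMap ∘ₗ f.rangeRestrict) *
      LinearMap.toMatrix' ((LinearMap.range f).subtype ∘ₗ b.toLinearMap) = 1 := by
    rw [← LinearMap.toMatrix'_comp]
    have : (b.symm.toLinearMap ∘ₗ f.rangeRestrict) ∘ₗ ((LinearMap.range f).subtype ∘ₗ b.toLinearMap)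
        = LinearMap.id := by
      refine LinearMap.ext fun x => ?_
      have hx : f.rangeRestrict (b x : n → F) = b x := by
        obtain ⟨y, hy⟩ := (b x).2
        apply Subtype.ext
        change f (b x) = b x
        rw [← hy]
        change f (f y) = f y
        simp [f, he]
      simp [hx]
    rw [this, LinearMap.toMatrix'_id]
  refine ⟨r, _, _, h1, h2, ?_⟩
  conv_lhs => rw [← h1]
  rw [Matrix.rank_mul_of_leftInverse _ _ h2, Fintype.card_fin]

/-- An idempotent `e` is a sum of `rank e` orthogonal idempotents equivalent to `E₀₀`, and
homomorphisms preserve such decompositions. -/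
theorem Matrix.rank_map_idempotent (f : Matrix n n F →ₐ[F] Matrix m m F) (i₀ : n)
    (e : Matrix n n F) (he : e * e = e) :
    (f e).rank = e.rank * (f (Matrix.single i₀ i₀ 1)).rank := by
  obtain ⟨r, P, Q, hPQ, hQP, hr⟩ := e.exists_factor_of_idempotent he
  obtain ⟨d, P₁, Q₁, hPQ₁, hQP₁, hd⟩ := (f (Matrix.single i₀ i₀ 1)).exists_factor_of_idempotent
    (by rw [← map_mul]; simp)
  rw [hr, hd]
  -- `e` is the sum of the products `a j * b j`, where `b j * a k = δ_{jk} E₀₀`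
  let a : Fin r → Matrix n n F := fun j => Matrix.of fun i k => if k = i₀ then P i j else 0
  let b : Fin r → Matrix n n F := fun j => Matrix.of fun i k => if i = i₀ then Q j k else 0
  have hba : ∀ j k, b j * a k = if j = k then Matrix.single i₀ i₀ 1 else 0 := by
    intro j k
    have h := congrFun (congrFun hQP j) k
    rw [Matrix.mul_apply, Matrix.one_apply] at h
    ext x y
    rw [Matrix.mul_apply]
    by_cases hx : x = i₀
    · by_cases hy : y = i₀
      · simp only [a, b, Matrix.of_apply, if_pos hx, if_pos hy, h]
        by_cases hjk : j = k <;> simp [hjk, hx, hy]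
      · have : Matrix.single i₀ i₀ (1 : F) x y = 0 :=
          Matrix.single_apply_of_ne _ _ _ _ _ (by tauto)
        by_cases hjk : j = k <;> simp [a, b, hjk, hy, this]
    · have : Matrix.single i₀ i₀ (1 : F) x y = 0 :=
        Matrix.single_apply_of_ne _ _ _ _ _ (by tauto)
      by_cases hjk : j = k <;> simp [a, b, hjk, hx, this]
  have hab : ∑ j, a j * Matrix.single i₀ i₀ 1 * b j = e := by
    rw [← hPQ]
    ext x y
    simp [Matrix.sum_apply, Matrix.mul_apply, a, b, Matrix.single_apply]
  let P₂ : Matrix m (Fin r × Fin d) F := Matrix.of fun x jk => (f (a jk.1) * P₁) x jk.2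
  let Q₂ : Matrix (Fin r × Fin d) m F := Matrix.of fun jk x => (Q₁ * f (b jk.1)) jk.2 x
  have h1 : Q₂ * P₂ = 1 := by
    ext ⟨j, x⟩ ⟨k, y⟩
    have : (Q₂ * P₂) (j, x) (k, y) = (Q₁ * f (b j) * (f (a k) * P₁)) x y := by
      simp [Matrix.mul_apply (M := Q₂), Matrix.mul_apply (M := Q₁ * f (b j)), P₂, Q₂]
    rw [this]
    have h2 : Q₁ * f (b j) * (f (a k) * P₁) = if j = k then 1 else 0 := by
      calc Q₁ * f (b j) * (f (a k) * P₁) = Q₁ * f (b j * a k) * P₁ := by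
            rw [map_mul]; simp only [Matrix.mul_assoc]
        _ = _ := by
            rw [hba]
            split_ifs
            · rw [← hPQ₁, ← Matrix.mul_assoc, hQP₁, Matrix.one_mul, hQP₁]
            · simp
    rw [h2]
    by_cases hjk : j = k <;> simp [hjk, Matrix.one_apply]
  have h2 : P₂ * Q₂ = f e := by
    rw [← hab, map_sum]
    ext x y
    have : ∀ j, f (a j * Matrix.single i₀ i₀ 1 * b j) = (f (a j) * P₁) * (Q₁ * f (b j)) := by
      intro j
      rw [map_mul, map_mul, ← hPQ₁]; simp only [Matrix.mul_assoc]
    simp only [this, Matrix.sum_apply, Matrix.mul_apply (M := P₂), Fintype.sum_prod_type]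
    refine Finset.sum_congr rfl fun j _ => ?_
    rw [Matrix.mul_apply]; rfl
  rw [← h2, Matrix.rank_mul_of_leftInverse P₂ Q₂ h1]
  simp

/-- Homomorphisms of matrix algebras preserve the normalized rank of idempotents. -/
theorem Matrix.rank_map_mul_card [Nonempty n] (f : Matrix n n F →ₐ[F] Matrix m m F)
    (e : Matrix n n F) (he : e * e = e) :
    (f e).rank * Fintype.card n = e.rank * Fintype.card m := by
  have i₀ : n := Classical.arbitrary n
  have h1 := Matrix.rank_map_idempotent f i₀ 1 (mul_one 1)
  rw [map_one, Matrix.rank_one, Matrix.rank_one] at h1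
  rw [Matrix.rank_map_idempotent f i₀ e he, h1]; ring

theorem Matrix.card_dvd_card [Nonempty n] (f : Matrix n n F →ₐ[F] Matrix m m F) :
    Fintype.card n ∣ Fintype.card m := by
  have i₀ : n := Classical.arbitrary n
  have h1 := Matrix.rank_map_idempotent f i₀ 1 (mul_one 1)
  rw [map_one, Matrix.rank_one, Matrix.rank_one] at h1
  exact ⟨_, h1⟩

/-- The Skolem–Noether theorem for homomorphisms of matrix algebras. -/
theorem Matrix.exists_conj_algHom [Nonempty n] (f g : Matrix n n F →ₐ[F] Matrix m m F) :
    ∃ u : (Matrix m m F)ˣ, ∀ x, g x = u * f x * (u⁻¹ : (Matrix m m F)ˣ) := by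
  have i₀ : n := Classical.arbitrary n
  have hid : ∀ h : Matrix n n F →ₐ[F] Matrix m m F,
      h (Matrix.single i₀ i₀ 1) * h (Matrix.single i₀ i₀ 1) = h (Matrix.single i₀ i₀ 1) := by
    intro h; rw [← map_mul]; simp
  have hrank : (f (Matrix.single i₀ i₀ 1)).rank = (g (Matrix.single i₀ i₀ 1)).rank := by
    have h1 := Matrix.rank_map_idempotent f i₀ 1 (mul_one 1)
    have h2 := Matrix.rank_map_idempotent g i₀ 1 (mul_one 1)
    rw [map_one, Matrix.rank_one, Matrix.rank_one] at h1 h2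
    exact Nat.eq_of_mul_eq_mul_left Fintype.card_pos (h1.symm.trans h2)
  obtain ⟨r, P, Q, hPQ, hQP, hr⟩ := (f (Matrix.single i₀ i₀ 1)).exists_factor_of_idempotent
    (hid f)
  obtain ⟨r', P', Q', hPQ', hQP', hr'⟩ :=
    (g (Matrix.single i₀ i₀ 1)).exists_factor_of_idempotent (hid g)
  obtain rfl : r = r' := by rw [← hr, ← hr', hrank]
  -- `c` and `d` exhibit the equivalence of the idempotents `f E₀₀` and `g E₀₀`
  obtain ⟨c, d, hcd, hdc, hc, hd⟩ : ∃ c d : Matrix m m F, c * d = g (Matrix.single i₀ i₀ 1) ∧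
      d * c = f (Matrix.single i₀ i₀ 1) ∧ g (Matrix.single i₀ i₀ 1) * c = c ∧
      f (Matrix.single i₀ i₀ 1) * d = d := by
    refine ⟨P' * Q, P * Q', ?_, ?_, ?_, ?_⟩
    · rw [Matrix.mul_assoc, ← Matrix.mul_assoc Q, hQP, Matrix.one_mul, hPQ']
    · rw [Matrix.mul_assoc, ← Matrix.mul_assoc Q', hQP', Matrix.one_mul, hPQ]
    · rw [← hPQ', Matrix.mul_assoc, ← Matrix.mul_assoc Q', hQP', Matrix.one_mul]
    · rw [← hPQ, Matrix.mul_assoc, ← Matrix.mul_assoc Q, hQP, Matrix.one_mul]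
  have key : ∀ (f g : Matrix n n F →ₐ[F] Matrix m m F) (c d : Matrix m m F),
      d * c = f (Matrix.single i₀ i₀ 1) → g (Matrix.single i₀ i₀ 1) * c = c →
      (∑ i, f (Matrix.single i i₀ 1) * d * g (Matrix.single i₀ i 1)) *
        (∑ i, g (Matrix.single i i₀ 1) * c * f (Matrix.single i₀ i 1)) = 1 := by
    intro f g c d hdc hc
    rw [Finset.sum_mul_sum]
    have h : ∀ i j, f (Matrix.single i i₀ 1) * d * g (Matrix.single i₀ i 1) *
        (g (Matrix.single j i₀ 1) * c * f (Matrix.single i₀ j 1)) =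
        if i = j then f (Matrix.single i i 1) else 0 := by
      intro i j
      have h1 : g (Matrix.single i₀ i 1) * g (Matrix.single j i₀ 1) =
          if i = j then g (Matrix.single i₀ i₀ 1) else 0 := by
        rw [← map_mul]
        split_ifs with hij
        · subst hij; simp
        · rw [Matrix.single_mul_single_of_ne _ _ _ _ hij, map_zero]
      calc _ = f (Matrix.single i i₀ 1) * d *
            ((g (Matrix.single i₀ i 1) * g (Matrix.single j i₀ 1)) * c) *
              f (Matrix.single i₀ j 1) := by simp only [Matrix.mul_assoc]
        _ = _ := by
          rw [h1]
          split_ifs with hij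
          · subst hij
            rw [hc, Matrix.mul_assoc (f _), hdc, ← map_mul, ← map_mul]
            simp
          · simp
    simp only [h, Finset.sum_ite_eq, Finset.mem_univ, if_true]
    rw [← map_sum, Matrix.sum_single_one, map_one]
  refine ⟨⟨_, _, key g f d c hcd hd, key f g c d hdc hc⟩, fun x => ?_⟩
  rw [Units.eq_mul_inv_iff_mul_eq]
  change g x * (∑ i, g (Matrix.single i i₀ 1) * c * f (Matrix.single i₀ i 1)) =
    (∑ i, g (Matrix.single i i₀ 1) * c * f (Matrix.single i₀ i 1)) * f x
  induction x using Matrix.induction_on' with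
  | h_zero => simp
  | h_add p q hp hq => rw [map_add, map_add, add_mul, mul_add, hp, hq]
  | h_std_basis k l t =>
    have h1 : ∀ h : Matrix n n F →ₐ[F] Matrix m m F,
        h (Matrix.single k l t) = t • h (Matrix.single k l 1) := by
      intro h; rw [← map_smul]; simp
    rw [h1 f, h1 g, smul_mul_assoc, mul_smul_comm]
    congr 1
    rw [Finset.mul_sum, Finset.sum_mul]
    rw [Finset.sum_eq_single l, Finset.sum_eq_single k]
    · rw [← Matrix.mul_assoc, ← Matrix.mul_assoc, ← map_mul, Matrix.mul_assoc _ (f _), ← map_mul]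
      simp
    · intro b _ hb
      rw [Matrix.mul_assoc, ← map_mul, Matrix.single_mul_single_of_ne _ _ _ _ hb]; simp
    · simp
    · intro b _ hb
      rw [← Matrix.mul_assoc, ← Matrix.mul_assoc, ← map_mul,
        Matrix.single_mul_single_of_ne _ _ _ _ (Ne.symm hb)]; simp
    · simp

end MatrixIdempotents

/-! ### Locally matrix algebras and their Steinitz numbers -/

section LocallyMatrix

variable {F : Type u} [Field F] {A : Type u} [Ring A] [Algebra F A]

theorem AlgHom.injective_of_matrix {ι : Type*} [Fintype ι] [DecidableEq ι] [Nonempty ι]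
    [Nontrivial A] (f : Matrix ι ι F →ₐ[F] A) : Function.Injective f :=
  RingHom.injective f.toRingHom

theorem IsLocallyMatrix.nontrivial (hA : IsLocallyMatrix F A) : Nontrivial A := by
  obtain ⟨B, -, n, ⟨e⟩⟩ := hA ∅
  have : Nontrivial B := e.toEquiv.nontrivial
  exact (Subtype.val_injective (p := fun x => x ∈ B)).nontrivial

theorem mem_matrixDegrees_iff [Nontrivial A] {n : ℕ+} :
    n ∈ matrixDegrees F A ↔ Nonempty (Matrix (Fin n) (Fin n) F →ₐ[F] A) := by
  constructor
  · rintro ⟨B, ⟨e⟩⟩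
    exact ⟨B.val.comp e.symm.toAlgHom⟩
  · rintro ⟨f⟩
    exact ⟨f.range, ⟨(AlgEquiv.ofInjective f f.injective_of_matrix).symm⟩⟩

theorem isLocallyMatrix_of_algHom [Nontrivial A]
    (h : ∀ S : Finset A, ∃ (ι : Type*) (_ : Fintype ι) (_ : DecidableEq ι) (_ : Nonempty ι)
      (f : Matrix ι ι F →ₐ[F] A), (S : Set A) ⊆ Set.range f) : IsLocallyMatrix F A := by
  intro S
  obtain ⟨ι, _, _, _, f, hf⟩ := h S
  refine ⟨f.range, hf, ⟨Fintype.card ι, Fintype.card_pos⟩, ⟨?_⟩⟩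
  exact (AlgEquiv.ofInjective f f.injective_of_matrix).symm.trans
    (Matrix.reindexAlgEquiv F F (Fintype.equivFin ι))

/-- A finite-dimensional subspace of a locally matrix algebra lies in a matrix subalgebra. -/
theorem IsLocallyMatrix.exists_algHom (hA : IsLocallyMatrix F A) (V : Submodule F A)
    [FiniteDimensional F V] :
    ∃ (n : ℕ+) (f : Matrix (Fin n) (Fin n) F →ₐ[F] A), ∀ x ∈ V, x ∈ f.range := by
  obtain ⟨S, hS⟩ : V.FG := (Submodule.fg_iff_finiteDimensional V).mpr inferInstance
  obtain ⟨B, hB, n, ⟨e⟩⟩ := hA S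
  refine ⟨n, B.val.comp e.symm.toAlgHom, fun x hx => ?_⟩
  have : V ≤ Subalgebra.toSubmodule B := by rw [← hS]; exact Submodule.span_le.mpr hB
  exact ⟨e ⟨x, this hx⟩, by simp⟩

/-- A homomorphism into `A` factors through every injective one of larger range. -/
theorem AlgHom.exists_factor {R S : Type*} [Ring R] [Algebra F R] [Ring S] [Algebra F S]
    (f : R →ₐ[F] A) (hf : Function.Injective f) (g : S →ₐ[F] A) (h : ∀ x, g x ∈ f.range) :
    ∃ k : S →ₐ[F] R, ∀ x, g x = f (k x) := by
  refine ⟨(AlgEquiv.ofInjective f hf).symm.toAlgHom.comp (g.codRestrict f.range h), fun x => ?_⟩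
  have : (AlgEquiv.ofInjective f hf) ((AlgEquiv.ofInjective f hf).symm
    (g.codRestrict f.range h x)) = g.codRestrict f.range h x := AlgEquiv.apply_symm_apply _ _
  exact (congrArg Subtype.val this).symm

/-- It suffices that the range of `f` contains the images of the matrix units under `g`. -/
theorem Matrix.card_dvd_card_of_range_le [Nontrivial A] {ι κ : Type*} [Fintype ι] [DecidableEq ι]
    [Nonempty ι] [Fintype κ] [DecidableEq κ] [Nonempty κ] (f : Matrix ι ι F →ₐ[F] A)
    (g : Matrix κ κ F →ₐ[F] A) (h : ∀ i j, g (Matrix.single i j 1) ∈ f.range) :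
    Fintype.card κ ∣ Fintype.card ι := by
  have hr : ∀ x, g x ∈ f.range := by
    intro x
    rw [Matrix.matrix_eq_sum_single x, map_sum]
    refine sum_mem fun a _ => ?_
    rw [map_sum]
    refine sum_mem fun b _ => ?_
    have : Matrix.single a b (x a b) = x a b • Matrix.single a b (1 : F) := by
      rw [Matrix.smul_single, smul_eq_mul, mul_one]
    rw [this, map_smul]
    exact Subalgebra.smul_mem _ (h a b) _
  obtain ⟨k, -⟩ := f.exists_factor f.injective_of_matrix g hr
  exact Matrix.card_dvd_card k

theorem Matrix.nonempty_algHom_of_dvd {n m : ℕ} (h : n ∣ m) :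
    Nonempty (Matrix (Fin n) (Fin n) F →ₐ[F] Matrix (Fin m) (Fin m) F) := by
  obtain ⟨d, rfl⟩ := h
  let f : Matrix (Fin n) (Fin n) F →ₐ[F] Matrix (Fin n × Fin d) (Fin n × Fin d) F :=
    { (Matrix.blockDiagonalRingHom (Fin n) (Fin d) F).comp (Pi.constRingHom (Fin d) _) with
      commutes' := fun r => by
        ext ⟨i, j⟩ ⟨k, l⟩
        simp [Matrix.blockDiagonal_apply, Matrix.algebraMap_matrix_apply]
        grind }
  exact ⟨(Matrix.reindexAlgEquiv F F finProdFinEquiv).toAlgHom.comp f⟩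

theorem steinitz_exponent_le_iff [Nontrivial A] {p : Nat.Primes} {x : ℕ∞} :
    (steinitz F A).exponent p ≤ x ↔ ∀ (n : ℕ+) (_ : Matrix (Fin n) (Fin n) F →ₐ[F] A),
      ((n : ℕ).factorization p : ℕ∞) ≤ x := by
  simp only [steinitz, SteinitzNumber.lcm, iSup_le_iff, mem_matrixDegrees_iff]
  exact ⟨fun h n f => h n ⟨f⟩, fun h n ⟨f⟩ => h n f⟩

theorem factorization_card_le_steinitz [Nontrivial A] {ι : Type*} [Fintype ι] [DecidableEq ι]
    [Nonempty ι] (f : Matrix ι ι F →ₐ[F] A) (p : Nat.Primes) :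
    ((Fintype.card ι).factorization p : ℕ∞) ≤ (steinitz F A).exponent p :=
  steinitz_exponent_le_iff.mp le_rfl ⟨Fintype.card ι, Fintype.card_pos⟩
    (f.comp (Matrix.reindexAlgEquiv F F (Fintype.equivFin ι)).symm.toAlgHom)

/-- In a locally matrix algebra `A`, matrix subalgebras whose degree is a multiple of a given
divisor `n` of `st(A)` are cofinal. -/
theorem IsLocallyMatrix.exists_algHom_dvd (hA : IsLocallyMatrix F A) (V : Submodule F A)
    [FiniteDimensional F V] (n : ℕ+)
    (hn : ∀ p : Nat.Primes, ((n : ℕ).factorization p : ℕ∞) ≤ (steinitz F A).exponent p) :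
    ∃ (m : ℕ+) (f : Matrix (Fin m) (Fin m) F →ₐ[F] A), (∀ x ∈ V, x ∈ f.range) ∧
      (n : ℕ) ∣ m := by
  have := hA.nontrivial
  have h : ∀ p : Nat.Primes, ∃ (k : ℕ+) (_ : Matrix (Fin k) (Fin k) F →ₐ[F] A),
      (n : ℕ).factorization p ≤ (k : ℕ).factorization p := by
    intro p
    by_contra! hcon
    obtain ⟨k₁, f₁, -⟩ := hA.exists_algHom ⊥
    have hpos := (Nat.zero_le _).trans_lt (hcon k₁ f₁)
    have : (steinitz F A).exponent p ≤ (((n : ℕ).factorization p - 1 : ℕ) : ℕ∞) :=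
      steinitz_exponent_le_iff.mpr fun k f => by
        have := hcon k f
        exact_mod_cast Nat.le_sub_one_of_lt this
    have := (hn p).trans this
    have h2 : (n : ℕ).factorization p ≤ (n : ℕ).factorization p - 1 := by exact_mod_cast this
    omega
  choose k g hk using h
  let W : Submodule F A := V ⊔ ⨆ p : (n : ℕ).primeFactors,
    Subalgebra.toSubmodule (g ⟨p, Nat.prime_of_mem_primeFactors p.2⟩).range
  have (p : Nat.Primes) : FiniteDimensional F (Subalgebra.toSubmodule (g p).range) :=
    inferInstanceAs (FiniteDimensional F (LinearMap.range (g p).toLinearMap))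
  have (p : (n : ℕ).primeFactors) : FiniteDimensional F
    (Subalgebra.toSubmodule (g ⟨p, Nat.prime_of_mem_primeFactors p.2⟩).range) := this _
  have : FiniteDimensional F W := Submodule.finite_sup _ _
  obtain ⟨m, f, hf⟩ := hA.exists_algHom W
  refine ⟨m, f, fun x hx => hf x (Submodule.mem_sup_left hx), ?_⟩
  rw [← Nat.factorization_prime_le_iff_dvd n.ne_zero m.ne_zero]
  intro p hp
  by_cases hpn : p ∈ (n : ℕ).primeFactors
  · refine (hk ⟨p, hp⟩).trans ?_
    obtain ⟨l, -⟩ := f.exists_factor f.injective_of_matrix (g ⟨p, hp⟩) fun x => hf _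
      (Submodule.mem_sup_right (Submodule.mem_iSup_of_mem (⟨p, hpn⟩ : (n : ℕ).primeFactors)
        ⟨x, rfl⟩))
    have := Matrix.card_dvd_card l
    simp only [Fintype.card_fin] at this
    exact (Nat.factorization_prime_le_iff_dvd (k _).ne_zero m.ne_zero).mpr this p hp
  · rw [Finsupp.notMem_support_iff.mp (by simpa using hpn)]
    exact Nat.zero_le _

/-- `n ∈ D(A)` if and only if `n` divides `st(A)`. -/
theorem IsLocallyMatrix.nonempty_algHom_iff (hA : IsLocallyMatrix F A) (n : ℕ+) :
    Nonempty (Matrix (Fin n) (Fin n) F →ₐ[F] A) ↔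
      ∀ p : Nat.Primes, ((n : ℕ).factorization p : ℕ∞) ≤ (steinitz F A).exponent p := by
  have := hA.nontrivial
  constructor
  · rintro ⟨f⟩ p
    exact steinitz_exponent_le_iff.mp le_rfl n f
  · intro h
    obtain ⟨m, f, -, hm⟩ := hA.exists_algHom_dvd ⊥ n h
    obtain ⟨g⟩ := Matrix.nonempty_algHom_of_dvd (F := F) hm
    exact ⟨f.comp g⟩

/-- The center of a locally matrix algebra consists of the scalars. -/
theorem IsLocallyMatrix.mem_center_iff (hA : IsLocallyMatrix F A) {z : A} :
    z ∈ Subring.center A ↔ ∃ c : F, algebraMap F A c = z := by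
  constructor
  · intro hz
    have := hA.nontrivial
    obtain ⟨n, f, hf⟩ := hA.exists_algHom (Submodule.span F {z})
    obtain ⟨x, hx⟩ := hf z (Submodule.mem_span_singleton_self z)
    have hx' : f x = z := hx
    have : x ∈ Set.center (Matrix (Fin n) (Fin n) F) := by
      rw [Semigroup.mem_center_iff]
      intro y
      apply f.injective_of_matrix
      rw [map_mul, map_mul, hx']
      exact Subring.mem_center_iff.mp hz (f y)
    rw [Matrix.center_eq_range] at this
    obtain ⟨c, hc⟩ := this
    refine ⟨c, ?_⟩
    rw [← f.commutes, ← hx', ← hc]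
    rfl
  · rintro ⟨c, rfl⟩
    exact Subring.mem_center_iff.mpr fun g => (Algebra.commutes c g).symm

/-- The ring `B` has a system of `n × n` matrix units with sum `1`. -/
def HasMatrixUnits (B : Type*) [Ring B] (n : ℕ) : Prop :=
  ∃ e : Fin n → Fin n → B, (∀ i j k l, e i j * e k l = if j = k then e i l else 0) ∧
    ∑ i, e i i = 1

/-- The existence of unital matrix subalgebras does not depend on the `F`-algebra structure. -/
theorem nonempty_algHom_iff_hasMatrixUnits {n : ℕ} :
    Nonempty (Matrix (Fin n) (Fin n) F →ₐ[F] A) ↔ HasMatrixUnits A n := by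
  constructor
  · rintro ⟨f⟩
    refine ⟨fun i j => f (Matrix.single i j 1), fun i j k l => ?_, ?_⟩
    · rw [← map_mul]
      split_ifs with h
      · subst h; simp
      · rw [Matrix.single_mul_single_of_ne _ _ _ _ h, map_zero]
    · rw [← map_sum, Matrix.sum_single_one, map_one]
  · rintro ⟨e, he, h1⟩
    let f : Matrix (Fin n) (Fin n) F →ₗ[F] A :=
      { toFun := fun x => ∑ i, ∑ j, x i j • e i j
        map_add' := fun x y => by simp [add_smul, Finset.sum_add_distrib]
        map_smul' := fun c x => by simp [mul_smul, Finset.smul_sum] }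
    refine ⟨AlgHom.ofLinearMap f ?_ ?_⟩
    · simp [f, Matrix.one_apply, h1]
    · intro x y
      change ∑ i, ∑ j, (x * y) i j • e i j =
        (∑ i, ∑ j, x i j • e i j) * (∑ i, ∑ j, y i j • e i j)
      have h : ∀ i j, x i j • e i j * (∑ k, ∑ l, y k l • e k l) =
          ∑ l, (x i j * y j l) • e i l := by
        intro i j
        simp only [Finset.mul_sum]
        rw [Finset.sum_eq_single j]
        · exact Finset.sum_congr rfl fun l _ => by
            rw [smul_mul_assoc, mul_smul_comm, he, if_pos rfl, mul_smul]
        · intro k _ hk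
          exact Finset.sum_eq_zero fun l _ => by
            rw [smul_mul_assoc, mul_smul_comm, he, if_neg (Ne.symm hk), smul_zero, smul_zero]
        · simp
      simp only [Finset.sum_mul, h, Matrix.mul_apply, Finset.sum_smul]
      exact Finset.sum_congr rfl fun i _ => Finset.sum_comm

theorem HasMatrixUnits.map {B C : Type*} [Ring B] [Ring C] (φ : B →+* C) {n : ℕ}
    (h : HasMatrixUnits B n) : HasMatrixUnits C n := by
  obtain ⟨e, he, h1⟩ := h
  refine ⟨fun i j => φ (e i j), fun i j k l => ?_, ?_⟩
  · rw [← map_mul, he]; split_ifs <;> simp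
  · rw [← map_sum, h1, map_one]

/-- The Steinitz number depends on the ring structure alone. -/
theorem steinitz_eq_of_ringEquiv {B : Type u} [Ring B] [Algebra F B] [Nontrivial A]
    (φ : A ≃+* B) : steinitz F A = steinitz F B := by
  have : Nontrivial B := φ.symm.toEquiv.nontrivial
  unfold steinitz
  congr 1
  ext n
  rw [mem_matrixDegrees_iff, mem_matrixDegrees_iff, nonempty_algHom_iff_hasMatrixUnits,
    nonempty_algHom_iff_hasMatrixUnits]
  exact ⟨HasMatrixUnits.map φ.toRingHom, HasMatrixUnits.map φ.symm.toRingHom⟩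

theorem IsLocallyMatrix.matrix (hA : IsLocallyMatrix F A) (k : ℕ) [NeZero k] :
    IsLocallyMatrix F (Matrix (Fin k) (Fin k) A) := by
  classical
  have := hA.nontrivial
  refine isLocallyMatrix_of_algHom fun S => ?_
  let V : Submodule F A := Submodule.span F
    (S.biUnion fun x => Finset.univ.image fun ij : Fin k × Fin k => x ij.1 ij.2 : Finset A)
  obtain ⟨n, f, hf⟩ := hA.exists_algHom V
  refine ⟨Fin k × Fin n, inferInstance, inferInstance, inferInstance,
    f.mapMatrix.comp (Matrix.compAlgEquiv (Fin k) (Fin n) F F).symm.toAlgHom, fun x hx => ?_⟩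
  have : ∀ i j, ∃ y, f y = x i j := fun i j => hf (x i j) (Submodule.subset_span (by
    simp only [Finset.coe_biUnion, Set.mem_iUnion, Finset.mem_coe]
    exact ⟨x, hx, Finset.mem_image.mpr ⟨(i, j), Finset.mem_univ _, rfl⟩⟩))
  choose y hy using this
  refine ⟨Matrix.compAlgEquiv (Fin k) (Fin n) F F (Matrix.of y), ?_⟩
  ext i j
  simp [hy]

end LocallyMatrix

/-! ### Corners of locally matrix algebras -/

section Corners

/-- The map `ψ` identifies the ring `C` with the corner `e R e`, where `e = ψ 1`. -/
structure IsCornerEmbedding {C R : Type*} [Ring C] [Ring R] (ψ : C →ₙ+* R) : Prop where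
  injective : Function.Injective ψ
  exists_eq : ∀ x, ψ 1 * x * ψ 1 = x → ∃ c, ψ c = x

variable {F : Type u} [Field F] {R C : Type u} [Ring R] [Algebra F R] [Ring C] [Algebra F C]
  {ψ : C →ₙ+* R}

/-- The corner of a matrix subalgebra at an idempotent `e` is a matrix algebra of degree
`rank e`. -/
theorem IsCornerEmbedding.exists_algHom (hψ : IsCornerEmbedding ψ)
    (hlin : ∀ (c : F) x, ψ (c • x) = c • ψ x)
    [Nontrivial C] {ι : Type*} [Fintype ι] [DecidableEq ι] (f : Matrix ι ι F →ₐ[F] R)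
    (hf : Function.Injective f) (e : Matrix ι ι F) (he : f e = ψ 1) :
    e * e = e ∧ 0 < e.rank ∧ ∃ g : Matrix (Fin e.rank) (Fin e.rank) F →ₐ[F] C,
      ∀ c, ψ c ∈ f.range → c ∈ g.range := by
  have hee : e * e = e := hf (by rw [map_mul, he, ← map_mul, one_mul])
  obtain ⟨r, P, Q, hPQ, hQP, hr⟩ := e.exists_factor_of_idempotent hee
  rw [hr]
  have hcor : ∀ x : Matrix (Fin r) (Fin r) F, ∃ c, ψ c = f (P * x * Q) := by
    intro x
    apply hψ.exists_eq
    rw [← he, ← map_mul, ← map_mul, ← hPQ]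
    congr 1
    calc P * Q * (P * x * Q) * (P * Q) = P * (Q * P) * x * (Q * P) * Q := by
          simp only [Matrix.mul_assoc]
      _ = _ := by simp [hQP]
  choose g hg using hcor
  let G : Matrix (Fin r) (Fin r) F →ₗ[F] C :=
    { toFun := g
      map_add' := fun x y => hψ.injective (by
        rw [map_add, hg, hg, hg, ← map_add, Matrix.mul_add, Matrix.add_mul])
      map_smul' := fun c x => hψ.injective (by
        rw [RingHom.id_apply, hlin, hg, hg, ← map_smul, Matrix.mul_smul, Matrix.smul_mul]) }
  let G' : Matrix (Fin r) (Fin r) F →ₐ[F] C := AlgHom.ofLinearMap G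
    (hψ.injective (by change ψ (g 1) = _; rw [hg, Matrix.mul_one, hPQ, he]))
    (fun x y => hψ.injective (by
      change ψ (g _) = ψ (g _ * g _)
      rw [map_mul, hg, hg, hg, ← map_mul]
      congr 1
      calc P * (x * y) * Q = P * x * (1 : Matrix (Fin r) (Fin r) F) * y * Q := by
            simp only [Matrix.mul_assoc, Matrix.one_mul]
        _ = _ := by rw [← hQP]; simp only [Matrix.mul_assoc]))
  refine ⟨hee, ?_, G', ?_⟩
  · rcases Nat.eq_zero_or_pos r with rfl | h
    · have h1 : (1 : Matrix (Fin 0) (Fin 0) F) = 0 := Subsingleton.elim _ _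
      have h2 := congrArg G' h1
      rw [map_one, map_zero] at h2
      exact absurd h2 one_ne_zero
    · exact h
  · rintro c ⟨y, hy⟩
    have hy' : f y = ψ c := hy
    refine ⟨Q * y * P, hψ.injective ?_⟩
    change ψ (g _) = _
    rw [hg]
    calc f (P * (Q * y * P) * Q) = f (P * Q * y * (P * Q)) := by simp only [Matrix.mul_assoc]
      _ = ψ c := by rw [hPQ, map_mul, map_mul, he, hy', ← map_mul, ← map_mul, one_mul, mul_one]

/-- A nonzero corner of a locally matrix algebra is a locally matrix algebra. -/
theorem IsCornerEmbedding.isLocallyMatrix (hψ : IsCornerEmbedding ψ)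
    (hlin : ∀ (c : F) x, ψ (c • x) = c • ψ x)
    [Nontrivial C] (hR : IsLocallyMatrix F R) : IsLocallyMatrix F C := by
  classical
  have := hR.nontrivial
  refine isLocallyMatrix_of_algHom fun S => ?_
  obtain ⟨n, f, hf⟩ := hR.exists_algHom
    (Submodule.span F ((insert 1 S).image ψ : Finset R))
  have hf' : ∀ c ∈ insert 1 S, ψ c ∈ f.range := fun c hc =>
    hf _ (Submodule.subset_span (Finset.mem_coe.mpr (Finset.mem_image_of_mem _ hc)))
  obtain ⟨e, he⟩ := hf' 1 (Finset.mem_insert_self _ _)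
  obtain ⟨-, hpos, g, hg⟩ := hψ.exists_algHom hlin f f.injective_of_matrix e he
  exact ⟨Fin e.rank, inferInstance, inferInstance, ⟨⟨0, hpos⟩⟩, g, fun c hc =>
    hg c (hf' c (Finset.mem_insert_of_mem hc))⟩

/-- If `C = e R e`, where `e` is an idempotent of rank `r` in a matrix subalgebra of degree `N`
of `R`, then `N · st(C) = r · st(R)`. -/
theorem IsCornerEmbedding.steinitz_exponent (hψ : IsCornerEmbedding ψ)
    (hlin : ∀ (c : F) x, ψ (c • x) = c • ψ x)
    [Nontrivial C] (hR : IsLocallyMatrix F R) {ι : Type*} [Fintype ι] [DecidableEq ι] [Nonempty ι]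
    (f : Matrix ι ι F →ₐ[F] R) (e : Matrix ι ι F) (he : f e = ψ 1) (p : Nat.Primes) :
    (Fintype.card ι).factorization p + (steinitz F C).exponent p =
      e.rank.factorization p + (steinitz F R).exponent p := by
  have := hR.nontrivial
  obtain ⟨hee, hpos, -⟩ := hψ.exists_algHom hlin f f.injective_of_matrix e he
  have hcard : Fintype.card ι ≠ 0 := Fintype.card_ne_zero
  -- every finite-dimensional subspace lies in a matrix subalgebra adapted to `f`
  have key : ∀ V : Submodule F R, FiniteDimensional F V → ∃ (n : ℕ+)
      (g : Matrix (Fin n) (Fin n) F →ₐ[F] R) (r : ℕ) (_ : 0 < r)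
      (k : Matrix (Fin r) (Fin r) F →ₐ[F] C), (∀ x ∈ V, x ∈ g.range) ∧
      (∀ c, ψ c ∈ g.range → c ∈ k.range) ∧
      r.factorization p + (Fintype.card ι).factorization p =
        e.rank.factorization p + (n : ℕ).factorization p := by
    intro V _
    have : FiniteDimensional F (Subalgebra.toSubmodule f.range) :=
      inferInstanceAs (FiniteDimensional F (LinearMap.range f.toLinearMap))
    obtain ⟨n, g, hg⟩ := hR.exists_algHom (V ⊔ Subalgebra.toSubmodule f.range)
    obtain ⟨h, hh⟩ := g.exists_factor g.injective_of_matrix f fun x =>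
      hg _ (Submodule.mem_sup_right ⟨x, rfl⟩)
    obtain ⟨-, hr, k, hk⟩ := hψ.exists_algHom hlin g g.injective_of_matrix (h e) (by rw [← hh, he])
    refine ⟨n, g, (h e).rank, hr, k, fun x hx => hg x (Submodule.mem_sup_left hx), hk, ?_⟩
    have := Matrix.rank_map_mul_card h e hee
    rw [Fintype.card_fin] at this
    have := congrArg (fun x => Nat.factorization x p) this
    simpa [Nat.factorization_mul hr.ne' hcard, Nat.factorization_mul hpos.ne' n.ne_zero] using this
  have hne : ∀ {D : Type u} [Ring D] [Algebra F D] [Nontrivial D],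
      (matrixDegrees F D).Nonempty := fun {D} _ _ _ => by
    have h1 : HasMatrixUnits D 1 :=
      ⟨fun _ _ => 1, fun i j k l => by simp [Subsingleton.elim j k], by simp⟩
    exact ⟨1, mem_matrixDegrees_iff.mpr (nonempty_algHom_iff_hasMatrixUnits.mpr h1)⟩
  apply le_antisymm
  · rw [steinitz, SteinitzNumber.lcm, ENat.add_biSup hne]
    refine iSup₂_le fun n hn => ?_
    obtain ⟨l⟩ := mem_matrixDegrees_iff.mp hn
    let ψ' : C →ₗ[F] R := { toFun := ψ, map_add' := map_add ψ, map_smul' := hlin }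
    obtain ⟨m, g, r, hr, k, hg, hk, heq⟩ := key (LinearMap.range (ψ'.comp l.toLinearMap))
      inferInstance
    have : Nonempty (Fin r) := ⟨⟨0, hr⟩⟩
    obtain ⟨q, -⟩ := k.exists_factor k.injective_of_matrix l fun x => hk _ (hg _ ⟨x, rfl⟩)
    have hnr := (Nat.factorization_prime_le_iff_dvd n.ne_zero hr.ne').mpr
      (by simpa using Matrix.card_dvd_card q) p p.2
    calc ((Fintype.card ι).factorization p + (n : ℕ).factorization p : ℕ∞)
        ≤ (Fintype.card ι).factorization p + r.factorization p := by gcongr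
      _ = e.rank.factorization p + (m : ℕ).factorization p := by
        rw [add_comm]; exact_mod_cast heq
      _ ≤ _ := by
        gcongr
        exact steinitz_exponent_le_iff.mp le_rfl m g
  · conv_lhs => rw [steinitz, SteinitzNumber.lcm, ENat.add_biSup hne]
    refine iSup₂_le fun n hn => ?_
    obtain ⟨l⟩ := mem_matrixDegrees_iff.mp hn
    obtain ⟨m, g, r, hr, k, hg, hk, heq⟩ := key (LinearMap.range l.toLinearMap) inferInstance
    have : Nonempty (Fin r) := ⟨⟨0, hr⟩⟩
    obtain ⟨q, -⟩ := g.exists_factor g.injective_of_matrix l fun x => hg _ ⟨x, rfl⟩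
    have hnm := (Nat.factorization_prime_le_iff_dvd n.ne_zero m.ne_zero).mpr
      (by simpa using Matrix.card_dvd_card q) p p.2
    calc (e.rank.factorization p + (n : ℕ).factorization p : ℕ∞)
        ≤ e.rank.factorization p + (m : ℕ).factorization p := by gcongr
      _ = (Fintype.card ι).factorization p + r.factorization p := by
        rw [add_comm (_ : ℕ∞) (r.factorization p : ℕ∞)]; exact_mod_cast heq.symm
      _ ≤ _ := by
        gcongr
        simpa using factorization_card_le_steinitz k p

/-- The embedding of `A` in `Mₖ(A)` as the corner at the matrix unit `E₀₀`. -/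
def Matrix.cornerHom (A : Type*) [Ring A] (k : ℕ) [NeZero k] : A →ₙ+* Matrix (Fin k) (Fin k) A where
  toFun a := Matrix.single 0 0 a
  map_mul' x y := by simp
  map_zero' := by simp
  map_add' x y := Matrix.single_add _ _ _ _

theorem Matrix.cornerHom_apply {A : Type*} [Ring A] (k : ℕ) [NeZero k] (a : A) :
    Matrix.cornerHom A k a = Matrix.single 0 0 a := rfl

theorem Matrix.isCornerEmbedding_cornerHom (A : Type*) [Ring A] (k : ℕ) [NeZero k] :
    IsCornerEmbedding (Matrix.cornerHom A k) := by
  constructor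
  · intro x y h
    simpa [Matrix.cornerHom_apply] using congrFun (congrFun h 0) 0
  · intro x hx
    refine ⟨x 0 0, ?_⟩
    rw [Matrix.cornerHom_apply, Matrix.single_mul_mul_single] at hx
    simpa [Matrix.cornerHom_apply] using hx

theorem IsLocallyMatrix.steinitz_matrix {A : Type u} [Ring A] [Algebra F A]
    (hA : IsLocallyMatrix F A) (k : ℕ) [NeZero k] (p : Nat.Primes) :
    (steinitz F (Matrix (Fin k) (Fin k) A)).exponent p =
      k.factorization p + (steinitz F A).exponent p := by
  have := hA.nontrivial
  have h := (Matrix.isCornerEmbedding_cornerHom A k).steinitz_exponent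
    (fun c x => by rw [Matrix.cornerHom_apply, Matrix.cornerHom_apply, Matrix.smul_single])
    (hA.matrix k) ((Algebra.ofId F A).mapMatrix) (Matrix.single 0 0 1)
    (by simp [Matrix.cornerHom_apply]) p
  have hr : (Matrix.single 0 0 1 : Matrix (Fin k) (Fin k) F).rank = 1 := by
    have h1 : (Matrix.single 0 0 1 : Matrix (Fin 1) (Fin k) F) *
        (Matrix.single 0 0 1 : Matrix (Fin k) (Fin 1) F) = 1 := by
      rw [Matrix.single_mul_single_same, mul_one]
      ext i j
      rw [Subsingleton.elim i 0, Subsingleton.elim j 0]; simp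
    have h2 := Matrix.rank_mul_of_leftInverse _ _ h1
    rwa [Matrix.single_mul_single_same, mul_one] at h2
  rw [hr] at h
  simpa using h.symm

end Corners

/-! ### Classification in countable dimension -/

section CountableDimension

variable {F : Type u} [Field F]

theorem exists_countable_span_eq_top {V : Type u} [AddCommGroup V] [Module F V]
    (h : Module.rank F V ≤ Cardinal.aleph0) :
    ∃ s : Set V, s.Countable ∧ Submodule.span F s = ⊤ := by
  let b := Module.Basis.ofVectorSpace F V
  refine ⟨Set.range b, ?_, b.span_eq⟩
  rw [← b.mk_eq_rank''] at h
  have := Cardinal.mk_le_aleph0_iff.mp h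
  exact Set.countable_range b

theorem rank_le_aleph0_of_span {V : Type u} [AddCommGroup V] [Module F V] {s : Set V}
    (hs : s.Countable) (h : Submodule.span F s = ⊤) : Module.rank F V ≤ Cardinal.aleph0 := by
  rw [← rank_top F V, ← h]
  exact (rank_span_le s).trans (Cardinal.le_aleph0_iff_set_countable.mpr hs)

variable {A B : Type u} [Ring A] [Algebra F A] [Ring B] [Algebra F B]

/-- The extension step of the back-and-forth argument: by the Skolem–Noether theorem, the extension
of `f` can be matched on the side of `B` by one that restricts to `g`. -/
theorem exists_extend_matrix_pair (hA : IsLocallyMatrix F A) (hB : IsLocallyMatrix F B)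
    (hst : steinitz F A = steinitz F B) {n : ℕ+} (f : Matrix (Fin n) (Fin n) F →ₐ[F] A)
    (g : Matrix (Fin n) (Fin n) F →ₐ[F] B) (a : A) :
    ∃ (m : ℕ+) (f' : Matrix (Fin m) (Fin m) F →ₐ[F] A) (g' : Matrix (Fin m) (Fin m) F →ₐ[F] B)
      (h : Matrix (Fin n) (Fin n) F →ₐ[F] Matrix (Fin m) (Fin m) F),
      (∀ x, f x = f' (h x)) ∧ (∀ x, g x = g' (h x)) ∧ a ∈ f'.range := by
  have := hA.nontrivial
  have := hB.nontrivial
  obtain ⟨m, f', hf'⟩ := hA.exists_algHom (LinearMap.range f.toLinearMap ⊔ Submodule.span F {a})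
  obtain ⟨h, hh⟩ := f'.exists_factor f'.injective_of_matrix f fun x =>
    hf' _ (Submodule.mem_sup_left ⟨x, rfl⟩)
  have ha := hf' a (Submodule.mem_sup_right (Submodule.mem_span_singleton_self a))
  obtain ⟨k, g₁, hg₁, hmk⟩ := hB.exists_algHom_dvd (LinearMap.range g.toLinearMap) m
    (by rw [← hst]; exact (hA.nonempty_algHom_iff m).mp ⟨f'⟩)
  obtain ⟨l, hl⟩ := g₁.exists_factor g₁.injective_of_matrix g fun x => hg₁ _ ⟨x, rfl⟩
  obtain ⟨j⟩ := Matrix.nonempty_algHom_of_dvd (F := F) hmk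
  obtain ⟨v, hv⟩ := Matrix.exists_conj_algHom (j.comp h) l
  let c : Matrix (Fin k) (Fin k) F →ₐ[F] Matrix (Fin k) (Fin k) F :=
    (MulSemiringAction.toAlgEquiv F _ (ConjAct.toConjAct v)).toAlgHom
  refine ⟨m, f', g₁.comp (c.comp j), h, hh, fun x => ?_, ha⟩
  rw [hl, hv]
  rfl

/-- The finite stages of the back-and-forth: subalgebras of `A × B` isomorphic to a matrix algebra,
that is, graphs of isomorphisms between matrix subalgebras of `A` and of `B`. -/
abbrev MatrixGraph (F A B : Type u) [Field F] [Ring A] [Algebra F A] [Ring B] [Algebra F B] :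
    Type u :=
  {Γ : Subalgebra F (A × B) // ∃ (n : ℕ+) (f : Matrix (Fin n) (Fin n) F →ₐ[F] A)
    (g : Matrix (Fin n) (Fin n) F →ₐ[F] B), Γ = (f.prod g).range}

theorem MatrixGraph.exists_fst (hA : IsLocallyMatrix F A) (hB : IsLocallyMatrix F B)
    (hst : steinitz F A = steinitz F B) (a : A) (Γ : MatrixGraph F A B) :
    ∃ Γ' : MatrixGraph F A B, (∃ b, (a, b) ∈ Γ'.1) ∧ Γ ≤ Γ' := by
  obtain ⟨Γ, n, f, g, rfl⟩ := Γ
  obtain ⟨m, f', g', h, hf, hg, y, hy⟩ := exists_extend_matrix_pair hA hB hst f g a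
  have hy' : f' y = a := hy
  refine ⟨⟨_, m, f', g', rfl⟩, ⟨g' y, y, by simp [hy']⟩, ?_⟩
  rintro _ ⟨x, rfl⟩
  exact ⟨h x, by simp [hf, hg]⟩

theorem MatrixGraph.exists_snd (hA : IsLocallyMatrix F A) (hB : IsLocallyMatrix F B)
    (hst : steinitz F A = steinitz F B) (b : B) (Γ : MatrixGraph F A B) :
    ∃ Γ' : MatrixGraph F A B, (∃ a, (a, b) ∈ Γ'.1) ∧ Γ ≤ Γ' := by
  obtain ⟨Γ, n, f, g, rfl⟩ := Γ
  obtain ⟨m, g', f', h, hg, hf, y, hy⟩ := exists_extend_matrix_pair hB hA hst.symm g f b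
  have hy' : g' y = b := hy
  refine ⟨⟨_, m, f', g', rfl⟩, ⟨f' y, y, by simp [hy']⟩, ?_⟩
  rintro _ ⟨x, rfl⟩
  exact ⟨h x, by simp [hf, hg]⟩

/-- Glimm's theorem: locally matrix algebras of countable dimension are classified by their
Steinitz numbers. -/
theorem IsLocallyMatrix.nonempty_algEquiv (hA : IsLocallyMatrix F A) (hB : IsLocallyMatrix F B)
    (hst : steinitz F A = steinitz F B) (hA' : Module.rank F A ≤ Cardinal.aleph0)
    (hB' : Module.rank F B ≤ Cardinal.aleph0) : Nonempty (A ≃ₐ[F] B) := by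
  have := hA.nontrivial
  have := hB.nontrivial
  obtain ⟨s, hs, hs'⟩ := exists_countable_span_eq_top hA'
  obtain ⟨t, ht, ht'⟩ := exists_countable_span_eq_top hB'
  have := hs.to_subtype
  have := ht.to_subtype
  let _ := Encodable.ofCountable (s ⊕ t)
  let 𝒟 : s ⊕ t → Order.Cofinal (MatrixGraph F A B) := Sum.elim
    (fun a => ⟨{Γ | ∃ b, ((a : A), b) ∈ Γ.1}, MatrixGraph.exists_fst hA hB hst a⟩)
    (fun b => ⟨{Γ | ∃ a, (a, (b : B)) ∈ Γ.1}, MatrixGraph.exists_snd hA hB hst b⟩)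
  obtain ⟨n, f, -⟩ := hA.exists_algHom ⊥
  obtain ⟨g⟩ := (hB.nonempty_algHom_iff n).mpr (hst ▸ (hA.nonempty_algHom_iff n).mp ⟨f⟩)
  let I := Order.idealOfCofinals (⟨_, n, f, g, rfl⟩ : MatrixGraph F A B) 𝒟
  have hI : Directed (· ≤ ·) fun Γ : I => Γ.1.1 := by
    intro Γ₁ Γ₂
    obtain ⟨Γ, hΓ, h₁, h₂⟩ := I.directed _ Γ₁.2 _ Γ₂.2
    exact ⟨⟨Γ, hΓ⟩, h₁, h₂⟩
  have : Nonempty I := I.nonempty.to_subtype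
  let D : Subalgebra F (A × B) := ⨆ Γ : I, Γ.1.1
  have hD : ∀ x, x ∈ D ↔ ∃ Γ : I, x ∈ Γ.1.1 := by
    intro x
    rw [← SetLike.mem_coe, Subalgebra.coe_iSup_of_directed hI]
    simp
  let π₁ : D →ₐ[F] A := (AlgHom.fst F A B).comp D.val
  let π₂ : D →ₐ[F] B := (AlgHom.snd F A B).comp D.val
  have h₁ : Function.Bijective π₁ := by
    constructor
    · rw [injective_iff_map_eq_zero]
      rintro ⟨x, hx⟩ h0
      obtain ⟨⟨⟨Γ, k, f', g', rfl⟩, -⟩, y, rfl⟩ := (hD x).mp hx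
      have h0' : f' y = 0 := h0
      have hy : y = 0 := f'.injective_of_matrix (by rw [h0', map_zero])
      ext <;> simp [hy]
    · rw [← Set.range_eq_univ]
      change (LinearMap.range π₁.toLinearMap : Set A) = _
      rw [show LinearMap.range π₁.toLinearMap = ⊤ from top_le_iff.mp ?_, Submodule.top_coe]
      rw [← hs', Submodule.span_le]
      intro a ha
      obtain ⟨Γ, ⟨b, hb⟩, hΓ⟩ := Order.cofinal_meets_idealOfCofinals
        (⟨_, n, f, g, rfl⟩ : MatrixGraph F A B) 𝒟 (Sum.inl ⟨a, ha⟩)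
      exact ⟨⟨(a, b), (hD _).mpr ⟨⟨Γ, hΓ⟩, hb⟩⟩, rfl⟩
  have h₂ : Function.Bijective π₂ := by
    constructor
    · rw [injective_iff_map_eq_zero]
      rintro ⟨x, hx⟩ h0
      obtain ⟨⟨⟨Γ, k, f', g', rfl⟩, -⟩, y, rfl⟩ := (hD x).mp hx
      have h0' : g' y = 0 := h0
      have hy : y = 0 := g'.injective_of_matrix (by rw [h0', map_zero])
      ext <;> simp [hy]
    · rw [← Set.range_eq_univ]
      change (LinearMap.range π₂.toLinearMap : Set B) = _
      rw [show LinearMap.range π₂.toLinearMap = ⊤ from top_le_iff.mp ?_, Submodule.top_coe]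
      rw [← ht', Submodule.span_le]
      intro b hb
      obtain ⟨Γ, ⟨a, ha⟩, hΓ⟩ := Order.cofinal_meets_idealOfCofinals
        (⟨_, n, f, g, rfl⟩ : MatrixGraph F A B) 𝒟 (Sum.inr ⟨b, hb⟩)
      exact ⟨⟨(a, b), (hD _).mpr ⟨⟨Γ, hΓ⟩, ha⟩⟩, rfl⟩
  exact ⟨(AlgEquiv.ofBijective π₁ h₁).symm.trans (AlgEquiv.ofBijective π₂ h₂)⟩

end CountableDimension

/-! ### Equivalences of module categories give corner embeddings -/

section Progenerator

open ModuleCat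

open scoped ModuleCat.Algebra

variable {A B : Type u} [Ring A] [Ring B]

/-- Right multiplication by `a`, an endomorphism of the left module `A`. -/
def ModuleCat.rightMul (a : A) : ModuleCat.of A A ⟶ ModuleCat.of A A :=
  ModuleCat.ofHom (LinearMap.toSpanSingleton A A a)

theorem ModuleCat.hom_ext_one {M : ModuleCat.{u} A} {f g : ModuleCat.of A A ⟶ M}
    (h : f.hom (1 : A) = g.hom (1 : A)) : f = g :=
  ModuleCat.hom_ext (LinearMap.ext_ring h)

theorem ModuleCat.rightMul_one_apply (a : A) : ((ModuleCat.rightMul a).hom (1 : A) : A) = a :=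
  one_mul a

theorem ModuleCat.eq_rightMul (f : ModuleCat.of A A ⟶ ModuleCat.of A A) :
    f = ModuleCat.rightMul (f.hom (1 : A)) :=
  ModuleCat.hom_ext_one (ModuleCat.rightMul_one_apply _).symm

theorem ModuleCat.rightMul_mul (a b : A) :
    ModuleCat.rightMul (a * b) = ModuleCat.rightMul a ≫ ModuleCat.rightMul b := by
  apply ModuleCat.hom_ext_one
  change (1 : A) * (a * b) = (1 * a) * b
  rw [mul_assoc]

theorem ModuleCat.rightMul_one : ModuleCat.rightMul (1 : A) = 𝟙 _ :=
  ModuleCat.hom_ext_one (ModuleCat.rightMul_one_apply _)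

theorem ModuleCat.rightMul_add (a b : A) :
    ModuleCat.rightMul (a + b) = ModuleCat.rightMul a + ModuleCat.rightMul b :=
  ModuleCat.hom_ext_one (mul_add (1 : A) a b)

theorem ModuleCat.comp_hom_one (f g : ModuleCat.of A A ⟶ ModuleCat.of A A) :
    ((f ≫ g).hom (1 : A) : A) = (f.hom (1 : A) : A) * (g.hom (1 : A) : A) := by
  conv_lhs => rw [eq_rightMul f, eq_rightMul g, ← rightMul_mul]
  exact rightMul_one_apply _

/-- Every equivalence sends the generator `A` to a generator, so the identity of `B` factors
through a finite power of the image of `A`. -/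
theorem ModuleCat.exists_factor_id (E : ModuleCat.{u} A ≌ ModuleCat.{u} B) :
    ∃ (k : ℕ) (g : Fin k → (ModuleCat.of B B ⟶ E.functor.obj (ModuleCat.of A A)))
      (f : Fin k → (E.functor.obj (ModuleCat.of A A) ⟶ ModuleCat.of B B)),
      ∑ i, g i ≫ f i = 𝟙 (ModuleCat.of B B) := by
  have : E.inverse.Additive := E.inverse.additive_of_preserves_binary_products
  have : E.functor.Additive := E.functor.additive_of_preserves_binary_products
  let T := E.functor.obj (ModuleCat.of A A)
  -- the trace ideal of `T` in `B`
  let tr : Submodule B B := ⨆ f : T ⟶ ModuleCat.of B B, LinearMap.range f.hom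
  have htr : (1 : B) ∈ tr := by
    by_contra h1
    let q : ModuleCat.of B B ⟶ ModuleCat.of B (B ⧸ tr) := ModuleCat.ofHom tr.mkQ
    have hq : q ≠ 0 := by
      intro h
      have : tr.mkQ 1 = 0 := congrArg (fun f => f.hom (1 : B)) h
      exact h1 ((Submodule.Quotient.mk_eq_zero tr).mp this)
    apply hq
    apply E.inverse.map_injective
    rw [Functor.map_zero]
    ext x
    let s : ModuleCat.of A A ⟶ E.inverse.obj (ModuleCat.of B B) :=
      ModuleCat.ofHom (LinearMap.toSpanSingleton A _ x)
    have h0 : E.functor.map s ≫ E.counit.app _ ≫ q = 0 := by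
      ext t
      have : (E.functor.map s ≫ E.counit.app (ModuleCat.of B B)).hom t ∈ tr :=
        Submodule.mem_iSup_of_mem (E.functor.map s ≫ E.counit.app (ModuleCat.of B B)) ⟨t, rfl⟩
      exact (Submodule.Quotient.mk_eq_zero tr).mpr this
    have h2 : s ≫ E.inverse.map q = 0 := by
      apply E.functor.map_injective
      rw [Functor.map_zero, Functor.map_comp, E.fun_inv_map, ← Category.assoc, ← Category.assoc,
        Category.assoc (E.functor.map s)]
      exact (congrArg (fun f => f ≫ E.counitInv.app _) h0).trans Limits.zero_comp
    have h3 : (s ≫ E.inverse.map q).hom (1 : A) = 0 := by rw [h2]; rfl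
    have h4 : s.hom (1 : A) = x := one_smul A x
    change (E.inverse.map q).hom (s.hom (1 : A)) = 0 at h3
    rw [h4] at h3
    exact h3
  obtain ⟨c, hc, hsum⟩ := (Submodule.mem_iSup_iff_exists_finsupp _ _).mp htr
  choose t ht using hc
  let e := c.support.equivFin.symm
  refine ⟨c.support.card, fun i => ModuleCat.ofHom (LinearMap.toSpanSingleton B T (t (e i))),
    fun i => e i, ModuleCat.hom_ext_one ?_⟩
  rw [ModuleCat.hom_sum, LinearMap.sum_apply]
  refine Eq.trans ?_ hsum
  rw [Finsupp.sum, ← Finset.sum_coe_sort c.support,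
    ← Equiv.sum_comp e (fun a => c a)]
  refine Finset.sum_congr rfl fun i _ => ?_
  rw [← ht]
  change (e i).1.hom ((1 : B) • t (e i)) = _
  rw [one_smul]

/-- An equivalence sends `B` to a module `Q` over `A` with endomorphism ring `Bᵒᵖ`, a direct summand
of some `Aᵏ`; so `B` is a corner of `Mₖ(A)`. -/
theorem exists_cornerEmbedding (E : ModuleCat.{u} A ≌ ModuleCat.{u} B) :
    ∃ (k : ℕ) (ψ : B →ₙ+* Matrix (Fin k) (Fin k) A), IsCornerEmbedding ψ ∧
      ∀ (F : Type u) [Field F] [Algebra F A] [Algebra F B], E.functor.Linear F →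
        ∀ (c : F) x, ψ (c • x) = c • ψ x := by
  have : E.inverse.Additive := E.inverse.additive_of_preserves_binary_products
  obtain ⟨k, g₀, f₀, h₀⟩ := ModuleCat.exists_factor_id E
  let Q := E.inverse.obj (ModuleCat.of B B)
  let g : Fin k → (Q ⟶ ModuleCat.of A A) := fun i => E.inverse.map (g₀ i) ≫ E.unitInv.app _
  let f : Fin k → (ModuleCat.of A A ⟶ Q) := fun i => E.unit.app _ ≫ E.inverse.map (f₀ i)
  have hgf : ∑ i, g i ≫ f i = 𝟙 Q := by
    rw [← E.inverse.map_id, ← h₀, Functor.map_sum]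
    simp [g, f]
  let θ : B → (Q ⟶ Q) := fun b => E.inverse.map (ModuleCat.rightMul b)
  have hθ_add : ∀ a b, θ (a + b) = θ a + θ b := by
    intro a b
    rw [← Functor.map_add, ← ModuleCat.rightMul_add]
  have hθ_mul : ∀ a b, θ (a * b) = θ a ≫ θ b := by
    intro a b
    rw [← Functor.map_comp, ← ModuleCat.rightMul_mul]
  have hθ_one : θ 1 = 𝟙 Q := by
    rw [← E.inverse.map_id, ← ModuleCat.rightMul_one]
  have hθ_inj : Function.Injective θ := by
    intro a b h
    have := congrArg (fun f => (f.hom (1 : B) : B)) (E.inverse.map_injective h)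
    exact (ModuleCat.rightMul_one_apply a).symm.trans
      (this.trans (ModuleCat.rightMul_one_apply b))
  have hθ_surj : ∀ φ : Q ⟶ Q, ∃ b, θ b = φ := by
    intro φ
    obtain ⟨φ', rfl⟩ := E.inverse.map_surjective φ
    exact ⟨_, congrArg _ (ModuleCat.eq_rightMul φ').symm⟩
  -- the matrix of an endomorphism of `Q`
  let M : (Q ⟶ Q) → Matrix (Fin k) (Fin k) A :=
    fun φ => Matrix.of fun i j => (f i ≫ φ ≫ g j).hom (1 : A)
  have hM_mul : ∀ φ χ, M (φ ≫ χ) = M φ * M χ := by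
    intro φ χ
    ext i j
    rw [Matrix.mul_apply]
    have : f i ≫ (φ ≫ χ) ≫ g j = ∑ l, (f i ≫ φ ≫ g l) ≫ (f l ≫ χ ≫ g j) := by
      calc f i ≫ (φ ≫ χ) ≫ g j = f i ≫ φ ≫ (∑ l, g l ≫ f l) ≫ χ ≫ g j := by
            rw [hgf]; simp
        _ = _ := by simp [Preadditive.comp_sum, Preadditive.sum_comp]
    change (f i ≫ (φ ≫ χ) ≫ g j).hom (1 : A) = _
    rw [this, ModuleCat.hom_sum, LinearMap.sum_apply]
    exact Finset.sum_congr rfl fun l _ => ModuleCat.comp_hom_one _ _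
  have hM_inj : ∀ φ χ, M φ = M χ → φ = χ := by
    intro φ χ h
    have h1 : ∀ i j, f i ≫ φ ≫ g j = f i ≫ χ ≫ g j := fun i j => by
      rw [ModuleCat.eq_rightMul (f i ≫ φ ≫ g j), ModuleCat.eq_rightMul (f i ≫ χ ≫ g j)]
      exact congrArg _ (congrFun (congrFun h i) j)
    have h2 : ∀ φ : Q ⟶ Q, φ = ∑ i, ∑ j, g i ≫ (f i ≫ φ ≫ g j) ≫ f j := fun φ => by
      calc φ = (∑ i, g i ≫ f i) ≫ φ ≫ (∑ j, g j ≫ f j) := by rw [hgf]; simp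
        _ = _ := by
          simp only [Preadditive.comp_sum, Preadditive.sum_comp, Category.assoc]
          exact Finset.sum_comm
    rw [h2 φ, h2 χ]
    simp only [h1]
  refine ⟨k, { toFun := fun b => M (θ b), map_mul' := ?_, map_zero' := ?_, map_add' := ?_ },
    ⟨?_, ?_⟩, ?_⟩
  · intro a b
    rw [hθ_mul, hM_mul]
  · have : θ 0 = 0 := by simpa using hθ_add 0 0
    rw [this]
    ext i j
    simp [M]
  · intro a b
    rw [hθ_add]
    ext i j
    simp [M]
  · intro a b h
    exact hθ_inj (hM_inj _ _ h)
  · intro x hx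
    change M (θ 1) * x * M (θ 1) = x at hx
    obtain ⟨b, hb⟩ := hθ_surj (∑ i, ∑ j, g i ≫ ModuleCat.rightMul (x i j) ≫ f j)
    refine ⟨b, ?_⟩
    refine Eq.trans ?_ hx
    change M (θ b) = _
    rw [hb, hθ_one]
    ext p q
    have h1 : f p ≫ (∑ i, ∑ j, g i ≫ ModuleCat.rightMul (x i j) ≫ f j) ≫ g q =
        ∑ i, ∑ j, (f p ≫ 𝟙 Q ≫ g i) ≫ ModuleCat.rightMul (x i j) ≫ (f j ≫ 𝟙 Q ≫ g q) := by
      simp [Preadditive.comp_sum, Preadditive.sum_comp]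
    change ((f p ≫ (∑ i, ∑ j, g i ≫ ModuleCat.rightMul (x i j) ≫ f j) ≫ g q).hom (1 : A) : A) = _
    rw [h1]
    simp only [ModuleCat.hom_sum, LinearMap.sum_apply]
    rw [Matrix.mul_assoc, Matrix.mul_apply]
    refine Finset.sum_congr rfl fun i _ => ?_
    rw [Matrix.mul_apply, Finset.mul_sum]
    refine Finset.sum_congr rfl fun j _ => ?_
    rw [ModuleCat.comp_hom_one, ModuleCat.comp_hom_one, ModuleCat.rightMul_one_apply]
    rfl
  · intro F _ _ _ hE c x
    change M (θ (c • x)) = c • M (θ x)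
    have : θ (c • x) = c • θ x := by
      rw [← Functor.map_smul]
      refine congrArg (fun φ => E.inverse.map φ) (ModuleCat.hom_ext_one ?_)
      change (1 : B) * (c • x) = algebraMap F B c * (1 * x)
      rw [one_mul, one_mul, Algebra.smul_def]
    rw [this]
    ext i j
    simp [M]

end Progenerator

/-! ### Arithmetic of Steinitz numbers -/

section SteinitzArithmetic

namespace SteinitzNumber

theorem ofPNat_mul_eq_iff {n m : ℕ+} {s t : SteinitzNumber} :
    ofPNat n * t = ofPNat m * s ↔ ∀ p : Nat.Primes, ((n : ℕ).factorization p : ℕ∞) + t.exponent p =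
      (m : ℕ).factorization p + s.exponent p := by
  rw [SteinitzNumber.ext_iff, funext_iff]
  rfl

theorem RationallyConnected.of_mul_eq {n m : ℕ+} {s t : SteinitzNumber}
    (h : ofPNat n * t = ofPNat m * s) : RationallyConnected s t :=
  ⟨_, m, n, rfl, h⟩

/-- Multiplication by a positive rational number is a partial function on Steinitz numbers. -/
theorem IsRatMul.unique {q : ℚ} {s t t' : SteinitzNumber} (h : IsRatMul q s t)
    (h' : IsRatMul q s t') : t = t' := by
  obtain ⟨m, n, hq, h⟩ := h
  obtain ⟨m', n', hq', h'⟩ := h'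
  rw [ofPNat_mul_eq_iff] at h h'
  have hmn : (m : ℕ) * n' = m' * n := by
    rw [hq'] at hq
    have h1 : (n : ℚ) ≠ 0 := by exact_mod_cast n.ne_zero
    have h2 : (n' : ℚ) ≠ 0 := by exact_mod_cast n'.ne_zero
    rw [div_eq_div_iff h2 h1] at hq
    exact_mod_cast hq.symm
  ext p
  have hp := congrArg (fun x => Nat.factorization x p) hmn
  simp only [Nat.factorization_mul m.ne_zero n'.ne_zero, Nat.factorization_mul m'.ne_zero n.ne_zero,
    Finsupp.add_apply] at hp
  have hp' : ((m : ℕ).factorization p : ℕ∞) + (n' : ℕ).factorization p =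
      (m' : ℕ).factorization p + (n : ℕ).factorization p := by exact_mod_cast hp
  have key : (((n : ℕ).factorization p + (n' : ℕ).factorization p : ℕ) : ℕ∞) + t.exponent p =
      (((n : ℕ).factorization p + (n' : ℕ).factorization p : ℕ) : ℕ∞) + t'.exponent p := by
    push_cast
    calc ((n : ℕ).factorization p : ℕ∞) + (n' : ℕ).factorization p + t.exponent p
        = (n' : ℕ).factorization p + ((n : ℕ).factorization p + t.exponent p) := by ring
      _ = ((m : ℕ).factorization p + (n' : ℕ).factorization p) + s.exponent p := by rw [h p]; ring
      _ = (n : ℕ).factorization p + ((n' : ℕ).factorization p + t'.exponent p) := by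
        rw [h' p, hp']; ring
      _ = _ := by ring
  exact WithTop.add_left_cancel (ENat.natCast_ne_top _) key

end SteinitzNumber

end SteinitzArithmetic

/-! ### Morita invariance -/

section MoritaInvariants

variable {F : Type u} [Field F]

/-- A corner of an `F`-algebra carries an `F`-algebra structure. -/
theorem IsCornerEmbedding.exists_algebra {R C : Type u} [Ring R] [Algebra F R] [Ring C]
    {ψ : C →ₙ+* R} (hψ : IsCornerEmbedding ψ) :
    ∃ _ : Algebra F C, ∀ (c : F) (x : C), ψ (c • x) = c • ψ x := by
  have h1 : ψ 1 * ψ 1 = ψ 1 := by rw [← map_mul, one_mul]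
  have h : ∀ c : F, ∃ x, ψ x = c • ψ 1 := fun c => hψ.exists_eq _ (by
    rw [mul_smul_comm, smul_mul_assoc, h1, h1])
  choose i hi using h
  let i' : F →+* C :=
    { toFun := i
      map_one' := hψ.injective (by rw [hi, one_smul])
      map_mul' := fun a b => hψ.injective (by
        rw [hi, map_mul, hi, hi, smul_mul_smul_comm, h1])
      map_zero' := hψ.injective (by rw [hi, zero_smul, map_zero])
      map_add' := fun a b => hψ.injective (by rw [hi, map_add, hi, hi, add_smul]) }
  have hleft : ∀ x, ψ 1 * ψ x = ψ x := fun x => by rw [← map_mul, one_mul]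
  have hright : ∀ x, ψ x * ψ 1 = ψ x := fun x => by rw [← map_mul, mul_one]
  refine ⟨i'.toAlgebra' fun c x => hψ.injective ?_, fun c x => ?_⟩
  · change ψ (i c * x) = ψ (x * i c)
    rw [map_mul, map_mul, hi, smul_mul_assoc, mul_smul_comm, hleft, hright]
  · change ψ (i c * x) = _
    rw [map_mul, hi, smul_mul_assoc, hleft]

variable {A B : Type u} [Ring A] [Algebra F A] [Ring B] [Algebra F B]

theorem rank_matrix_le_aleph0 (h : Module.rank F A ≤ Cardinal.aleph0) (k : ℕ) :
    Module.rank F (Matrix (Fin k) (Fin k) A) ≤ Cardinal.aleph0 := by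
  obtain ⟨s, hs, hs'⟩ := exists_countable_span_eq_top h
  refine rank_le_aleph0_of_span (s := ⋃ ij : Fin k × Fin k, Matrix.single ij.1 ij.2 '' s)
    (Set.countable_iUnion fun _ => hs.image _) (top_le_iff.mp fun x _ => ?_)
  rw [Matrix.matrix_eq_sum_single x]
  refine Submodule.sum_mem _ fun i _ => Submodule.sum_mem _ fun j _ => ?_
  have : ∀ a ∈ Submodule.span F s, Matrix.single i j a ∈
      Submodule.span F (⋃ ij : Fin k × Fin k, Matrix.single ij.1 ij.2 '' s) := by
    intro a ha
    induction ha using Submodule.span_induction with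
    | mem a ha => exact Submodule.subset_span (Set.mem_iUnion.mpr ⟨(i, j), a, ha, rfl⟩)
    | zero => simp
    | add a b _ _ ha hb => rw [Matrix.single_add]; exact add_mem ha hb
    | smul c a _ ha => rw [← Matrix.smul_single]; exact Submodule.smul_mem _ _ ha
  exact this _ (hs' ▸ Submodule.mem_top)

/-- The invariants of `A` that a linear corner embedding `B → Mₖ(A)` transfers to `B`. -/
theorem IsCornerEmbedding.morita_invariants (hA : IsLocallyMatrix F A) [Nontrivial B] {k : ℕ}
    {ψ : B →ₙ+* Matrix (Fin k) (Fin k) A} (hψ : IsCornerEmbedding ψ)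
    (hlin : ∀ (c : F) x, ψ (c • x) = c • ψ x) :
    IsLocallyMatrix F B ∧ (steinitz F A).RationallyConnected (steinitz F B) ∧
      (Module.rank F A ≤ Cardinal.aleph0 → Module.rank F B ≤ Cardinal.aleph0) := by
  have hk : NeZero k := ⟨by
    rintro rfl
    exact one_ne_zero (hψ.injective (Subsingleton.elim (ψ 1) (ψ 0)))⟩
  have hR := hA.matrix k
  refine ⟨hψ.isLocallyMatrix hlin hR, ?_, fun h => ?_⟩
  · have := hR.nontrivial
    obtain ⟨n, f, hf⟩ := hR.exists_algHom (Submodule.span F {ψ 1})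
    obtain ⟨e, he⟩ := hf _ (Submodule.mem_span_singleton_self _)
    have he' : f e = ψ 1 := he
    obtain ⟨-, hpos, -⟩ := hψ.exists_algHom hlin f f.injective_of_matrix e he'
    refine SteinitzNumber.RationallyConnected.of_mul_eq (n := n)
      (m := ⟨e.rank, hpos⟩ * ⟨k, Nat.pos_of_neZero k⟩)
      (SteinitzNumber.ofPNat_mul_eq_iff.mpr fun p => ?_)
    have := hψ.steinitz_exponent hlin hR f e he' p
    rw [hA.steinitz_matrix k p, Fintype.card_fin] at this
    rw [this, ← add_assoc]
    change _ = (((e.rank * k).factorization p : ℕ) : ℕ∞) + _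
    rw [Nat.factorization_mul hpos.ne' (NeZero.ne k)]
    simp
  · let ψ' : B →ₗ[F] Matrix (Fin k) (Fin k) A :=
      { toFun := ψ, map_add' := map_add ψ, map_smul' := hlin }
    exact (LinearMap.rank_le_of_injective ψ' hψ.injective).trans (rank_matrix_le_aleph0 h k)

theorem IsMoritaEquivalent.moritaEquivalent (h : IsMoritaEquivalent F A B) :
    MoritaEquivalent A B :=
  h.cond.map fun e => e.eqv

theorem MoritaEquivalent.nontrivial (h : MoritaEquivalent A B) [Nontrivial A] : Nontrivial B := by
  obtain ⟨E⟩ := h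
  obtain ⟨k, ψ, hψ, -⟩ := exists_cornerEmbedding E.symm
  by_contra hB
  rw [not_nontrivial_iff_subsingleton] at hB
  exact zero_ne_one (hψ.injective (Subsingleton.elim (ψ 0) (ψ 1)))

theorem IsMoritaEquivalent.invariants (hA : IsLocallyMatrix F A) (h : IsMoritaEquivalent F A B) :
    IsLocallyMatrix F B ∧ (steinitz F A).RationallyConnected (steinitz F B) ∧
      (Module.rank F A ≤ Cardinal.aleph0 → Module.rank F B ≤ Cardinal.aleph0) := by
  have := hA.nontrivial
  have := h.moritaEquivalent.nontrivial
  obtain ⟨⟨e⟩⟩ := h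
  obtain ⟨k, ψ, hψ, hlin⟩ := exists_cornerEmbedding e.eqv
  exact hψ.morita_invariants hA (hlin F e.linear)

/-- Countability of the dimension depends on the ring and on its center only. -/
theorem IsLocallyMatrix.rank_le_aleph0_of_ringEquiv (hB : IsLocallyMatrix F B) (φ : A ≃+* B)
    (h : Module.rank F A ≤ Cardinal.aleph0) : Module.rank F B ≤ Cardinal.aleph0 := by
  obtain ⟨s, hs, hs'⟩ := exists_countable_span_eq_top h
  refine rank_le_aleph0_of_span (hs.image φ) (top_le_iff.mp fun b _ => ?_)
  obtain ⟨a, rfl⟩ := φ.surjective b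
  have ha : a ∈ Submodule.span F s := hs' ▸ Submodule.mem_top
  induction ha using Submodule.span_induction with
  | mem a ha => exact Submodule.subset_span ⟨a, ha, rfl⟩
  | zero => rw [map_zero]; exact zero_mem _
  | add x y _ _ hx hy => rw [map_add]; exact add_mem (hx trivial) (hy trivial)
  | smul c x _ hx =>
    have hc : φ (algebraMap F A c) ∈ Subring.center B := Subring.mem_center_iff.mpr fun g => by
      obtain ⟨g, rfl⟩ := φ.surjective g
      rw [← map_mul, ← map_mul, Algebra.commutes]
    obtain ⟨d, hd⟩ := hB.mem_center_iff.mp hc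
    rw [Algebra.smul_def, map_mul, ← hd, ← Algebra.smul_def]
    exact Submodule.smul_mem _ _ (hx trivial)

/-- An equivalence of module categories that is not `F`-linear embeds `B` in `Mₖ(A)` with a
possibly different `F`-algebra structure, to which the invariants are insensitive. -/
theorem MoritaEquivalent.invariants (hA : IsLocallyMatrix F A) (hB : IsLocallyMatrix F B)
    (h : MoritaEquivalent A B) : (steinitz F A).RationallyConnected (steinitz F B) ∧
      (Module.rank F A ≤ Cardinal.aleph0 → Module.rank F B ≤ Cardinal.aleph0) := by
  have := hB.nontrivial
  obtain ⟨E⟩ := h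
  obtain ⟨k, ψ, hψ, -⟩ := exists_cornerEmbedding E
  obtain ⟨C, _, _, φ, -, h1, h2⟩ : ∃ (C : Type u) (_ : Ring C) (_ : Algebra F C) (_ : C ≃+* B),
      IsLocallyMatrix F C ∧ (steinitz F A).RationallyConnected (steinitz F C) ∧
      (Module.rank F A ≤ Cardinal.aleph0 → Module.rank F C ≤ Cardinal.aleph0) := by
    obtain ⟨inst, hlin⟩ := hψ.exists_algebra (F := F)
    exact ⟨B, inferInstance, inst, RingEquiv.refl B,
      @IsCornerEmbedding.morita_invariants F _ A B _ _ _ inst hA _ k ψ hψ hlin⟩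
  have : Nontrivial C := φ.toEquiv.nontrivial
  rw [steinitz_eq_of_ringEquiv φ] at h1
  exact ⟨h1, fun h => hB.rank_le_aleph0_of_ringEquiv φ (h2 h)⟩

theorem InMoritaClass.invariants (hA : IsLocallyMatrix F A) (h : InMoritaClass F A B) :
    IsLocallyMatrix F B ∧ (steinitz F A).RationallyConnected (steinitz F B) ∧
      (Module.rank F A ≤ Cardinal.aleph0 → Module.rank F B ≤ Cardinal.aleph0) := by
  rcases h with h | ⟨hB, h⟩
  · exact h.invariants hA
  · exact ⟨hB, h.invariants hA hB⟩

/-- In countable dimension, if `n · st(B) = m · st(A)` then `Mₙ(B)` and `Mₘ(A)` are isomorphic. -/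
theorem IsLocallyMatrix.isMoritaEquivalent (hA : IsLocallyMatrix F A) (hB : IsLocallyMatrix F B)
    (hA' : Module.rank F A ≤ Cardinal.aleph0) (hB' : Module.rank F B ≤ Cardinal.aleph0)
    (h : (steinitz F A).RationallyConnected (steinitz F B)) : IsMoritaEquivalent F A B := by
  obtain ⟨q, m, n, -, h⟩ := h
  have hst : steinitz F (Matrix (Fin m) (Fin m) A) = steinitz F (Matrix (Fin n) (Fin n) B) := by
    ext p
    rw [hA.steinitz_matrix, hB.steinitz_matrix, SteinitzNumber.ofPNat_mul_eq_iff.mp h p]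
  obtain ⟨e⟩ := (hA.matrix m).nonempty_algEquiv (hB.matrix n) hst (rank_matrix_le_aleph0 hA' m)
    (rank_matrix_le_aleph0 hB' n)
  exact (IsMoritaEquivalent.matrix A F).trans F
    ((IsMoritaEquivalent.of_algEquiv F e).trans F ((IsMoritaEquivalent.matrix B F).symm F))

/-- Countably many algebras in the Morita class of `A` realize all Steinitz numbers that occur. -/
theorem IsLocallyMatrix.exists_seq_steinitz (hA : IsLocallyMatrix F A) :
    ∃ C : ℕ → AlgCat.{u} F, (∀ n, InMoritaClass F A (C n)) ∧
      ∀ (B : Type u) [Ring B] [Algebra F B], InMoritaClass F A B →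
        ∃ n, steinitz F B = steinitz F (C n) := by
  have h : ∀ q : ℚ, ∃ D : AlgCat.{u} F, InMoritaClass F A D ∧
      ∀ (B : Type u) [Ring B] [Algebra F B], InMoritaClass F A B →
        (steinitz F A).IsRatMul q (steinitz F B) → steinitz F B = steinitz F D := by
    intro q
    by_cases hq : ∃ D : AlgCat.{u} F, InMoritaClass F A D ∧
      (steinitz F A).IsRatMul q (steinitz F D)
    · obtain ⟨D, hD, hDq⟩ := hq
      exact ⟨D, hD, fun B _ _ _ hBq => hBq.unique hDq⟩
    · exact ⟨AlgCat.of F A, Or.inl (IsMoritaEquivalent.refl F A), fun B _ _ hB hBq =>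
        absurd ⟨AlgCat.of F B, hB, hBq⟩ hq⟩
  choose D hD hDq using h
  obtain ⟨e, he⟩ := exists_surjective_nat ℚ
  refine ⟨fun n => D (e n), fun n => hD _, fun B _ _ hB => ?_⟩
  obtain ⟨q, hq⟩ := (hB.invariants hA).2.1
  obtain ⟨n, rfl⟩ := he q
  exact ⟨n, hDq _ B hB hq⟩

end MoritaInvariants

/-! ### Universal sentences -/

section UniversalTheory

open FirstOrder FirstOrder.Language

variable {F : Type u} [Field F] {A B : Type u} [Ring A] [Algebra F A] [Ring B] [Algebra F B]

/-- An injective homomorphism of algebras is an embedding of algebraic systems. -/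
def AlgHom.toEmbedding (f : A →ₐ[F] B) (hf : Function.Injective f) : A ↪[algebraLanguage F] B where
  toFun := f
  inj' := hf
  map_fun' := by
    intro n φ x
    cases φ
    · exact map_zero f
    · exact map_one f
    · exact map_neg f _
    · exact map_smul f _ _
    · exact map_add f _ _
    · exact map_mul f _ _
  map_rel' := fun r => nomatch r

/-- A universal formula that fails fails in every subalgebra containing a certain finite set. -/
theorem exists_finset_not_realize {n : ℕ} {φ : (algebraLanguage F).BoundedFormula Empty n}
    (hφ : φ.IsUniversal) (v : Empty → A) (xs : Fin n → A) (h : ¬ φ.Realize v xs) :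
    ∃ S : Finset A, ∀ (D : Type u) [Ring D] [Algebra F D] (f : D →ₐ[F] A),
      Function.Injective f → (S : Set A) ⊆ Set.range f → ∀ (w : Empty → D) (ys : Fin n → D),
        f ∘ ys = xs → ¬ φ.Realize w ys := by
  classical
  induction hφ with
  | of_isQF hQF =>
    refine ⟨∅, fun D _ _ f hf _ w ys hys hr => h ?_⟩
    have hf' : (f.toEmbedding hf : D → A) ∘ w = v := Subsingleton.elim _ _
    have := (hQF.realize_embedding (f.toEmbedding hf) (v := w) (xs := ys)).mpr hr
    rwa [hf', show (f.toEmbedding hf : D → A) ∘ ys = xs from hys] at this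
  | all hψ ih =>
    rw [BoundedFormula.realize_all] at h
    push Not at h
    obtain ⟨a, ha⟩ := h
    obtain ⟨S, hS⟩ := ih _ ha
    refine ⟨insert a S, fun D _ _ f hf hr w ys hys hreal => ?_⟩
    rw [Finset.coe_insert, Set.insert_subset_iff] at hr
    obtain ⟨⟨d, hd⟩, hr⟩ := hr
    refine hS D f hf hr w (Fin.snoc ys d) ?_ (hreal d)
    rw [Fin.comp_snoc, hys, hd]

theorem IsLocallyMatrix.realize_of_isUniversal (hA : IsLocallyMatrix F A)
    (hB : IsLocallyMatrix F B) (hst : steinitz F A = steinitz F B)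
    {φ : (algebraLanguage F).Sentence} (hφ : BoundedFormula.IsUniversal φ)
    (h : Sentence.Realize B φ) : Sentence.Realize A φ := by
  have := hA.nontrivial
  have := hB.nontrivial
  by_contra hn
  obtain ⟨S, hS⟩ := exists_finset_not_realize hφ default default hn
  obtain ⟨n, f, hf⟩ := hA.exists_algHom (Submodule.span F S)
  obtain ⟨g⟩ := (hB.nonempty_algHom_iff n).mpr (hst ▸ (hA.nonempty_algHom_iff n).mp ⟨f⟩)
  refine hS (Matrix (Fin n) (Fin n) F) f f.injective_of_matrix
    (fun x hx => hf x (Submodule.subset_span hx)) default default (Subsingleton.elim _ _) ?_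
  refine hφ.realize_embedding (g.toEmbedding g.injective_of_matrix) ?_
  rw [Subsingleton.elim (_ ∘ (default : Empty → Matrix (Fin n) (Fin n) F)) (default : Empty → B),
    Subsingleton.elim (_ ∘ (default : Fin 0 → Matrix (Fin n) (Fin n) F)) (default : Fin 0 → B)]
  exact h

/-- A universal sentence holds in a locally matrix algebra if and only if it holds in all of its
matrix subalgebras, and these are determined by the Steinitz number. -/
theorem IsLocallyMatrix.universallyEquivalent (hA : IsLocallyMatrix F A)
    (hB : IsLocallyMatrix F B) (hst : steinitz F A = steinitz F B) :
    UniversallyEquivalent F A B :=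
  fun _ hφ => ⟨hB.realize_of_isUniversal hA hst.symm hφ,
    hA.realize_of_isUniversal hB hst hφ⟩

end UniversalTheory

/-! ### Matrix algebras from finite retractions of a group -/

section FiniteRetractions

/-- The multiplication operator by a function. -/
def mulOp {X : Type*} {F : Type*} [Field F] (h : X → F) : Module.End F (X → F) where
  toFun f := h * f
  map_add' := mul_add h
  map_smul' c f := by ext x; simp [mul_left_comm]

theorem mulOp_apply {X : Type*} {F : Type*} [Field F] (h f : X → F) (x : X) :
    mulOp h f x = h x * f x := rfl

/-- An idempotent endomorphism of the group `G` with finitely many values. It splits `G` as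
`Pt × ker`, and lets the matrices over `Pt` act on the functions on `G`. -/
structure FiniteRetraction (G : Type*) [AddCommGroup G] where
  /-- The underlying endomorphism. -/
  toHom : G →+ G
  idem : ∀ x, toHom (toHom x) = toHom x
  finite : (Set.range toHom).Finite

namespace FiniteRetraction

variable {G : Type u} [AddCommGroup G]

/-- The image of the retraction, as the type of its fixed points. -/
@[ext]
structure Pt (π : FiniteRetraction G) : Type u where
  /-- The underlying element of the group. -/
  val : G
  fixed : π.toHom val = val

variable (π ρ : FiniteRetraction G)

noncomputable instance : DecidableEq π.Pt := Classical.decEq _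

instance : Finite π.Pt :=
  have := π.finite.to_subtype
  Finite.of_injective (fun b : π.Pt => (⟨b.1, b.1, b.2⟩ : Set.range π.toHom))
    fun _ _ h => Pt.ext (congrArg Subtype.val h)

noncomputable instance : Fintype π.Pt := Fintype.ofFinite _

/-- The retraction, as a map onto its image. -/
def proj (x : G) : π.Pt := ⟨π.toHom x, π.idem x⟩

instance : Nonempty π.Pt := ⟨π.proj 0⟩

theorem toHom_coe (b : π.Pt) : π.toHom b.1 = b.1 := b.2

theorem proj_coe (b : π.Pt) : π.proj b.1 = b := Pt.ext b.2

theorem toHom_shift (x : G) (b : π.Pt) : π.toHom (x - π.toHom x + b.1) = b.1 := by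
  rw [map_add, map_sub, π.idem, toHom_coe]; abel

theorem proj_shift (x : G) (b : π.Pt) : π.proj (x - π.toHom x + b.1) = b :=
  Pt.ext (π.toHom_shift x b)

theorem shift_shift (x : G) (b c : π.Pt) :
    x - π.toHom x + b.1 - π.toHom (x - π.toHom x + b.1) + c.1 = x - π.toHom x + c.1 := by
  rw [toHom_shift]; abel

theorem shift_proj (x : G) : x - π.toHom x + (π.proj x).1 = x := by
  simp [proj]

variable {F : Type u} [Field F]

/-- The action of matrices over `Pt` on functions on `G`, through the first factor of
`G ≃ Pt × ker`. -/
noncomputable def act : Matrix π.Pt π.Pt F →ₐ[F] Module.End F (G → F) :=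
  AlgHom.ofLinearMap
    { toFun := fun m =>
        { toFun := fun f x => ∑ b, m (π.proj x) b * f (x - π.toHom x + b.1)
          map_add' := fun f g => by ext x; simp [mul_add, Finset.sum_add_distrib]
          map_smul' := fun c f => by ext x; simp [Finset.mul_sum, mul_left_comm] }
      map_add' := fun m n => by
        refine LinearMap.ext fun f => funext fun x => ?_
        simp [add_mul, Finset.sum_add_distrib]
      map_smul' := fun c m => by
        refine LinearMap.ext fun f => funext fun x => ?_
        simp [Finset.mul_sum, mul_assoc] }
    (by
      refine LinearMap.ext fun f => funext fun x => ?_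
      simp [Matrix.one_apply, shift_proj])
    (fun m n => by
      refine LinearMap.ext fun f => funext fun x => ?_
      simp only [LinearMap.coe_mk, AddHom.coe_mk, Module.End.mul_apply, proj_shift, shift_shift,
        Matrix.mul_apply, Finset.sum_mul, Finset.mul_sum, mul_assoc]
      exact Finset.sum_comm)

theorem act_apply (m : Matrix π.Pt π.Pt F) (f : G → F) (x : G) :
    π.act m f x = ∑ b, m (π.proj x) b * f (x - π.toHom x + b.1) := rfl

theorem act_single_apply (a b : π.Pt) (f : G → F) (x : G) :
    π.act (Matrix.single a b 1) f x = if a = π.proj x then f (x - π.toHom x + b.1) else 0 := by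
  rw [act_apply, Finset.sum_eq_single b]
  · by_cases h : a = π.proj x <;> simp [h]
  · intro c _ hc
    simp [hc.symm]
  · simp

/-- The functions that factor through `π` act as diagonal matrices. -/
theorem mulOp_mem_range (h : G → F) (hh : ∀ x, h (π.toHom x) = h x) :
    mulOp h ∈ (π.act (F := F)).range := by
  refine ⟨Matrix.diagonal fun b => h b.1, LinearMap.ext fun f => funext fun x => ?_⟩
  change π.act (Matrix.diagonal fun b => h b.1) f x = _
  rw [act_apply, Finset.sum_eq_single (π.proj x)]
  · rw [Matrix.diagonal_apply_eq, shift_proj, mulOp_apply]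
    exact congrArg (· * f x) (hh x)
  · intro b _ hb
    rw [Matrix.diagonal_apply_ne' _ hb, zero_mul]
  · simp

/-- The order of idempotents: `π ≤ ρ` means `π ρ = ρ π = π`. -/
instance : LE (FiniteRetraction G) :=
  ⟨fun π ρ => (∀ x, π.toHom (ρ.toHom x) = π.toHom x) ∧ ∀ x, ρ.toHom (π.toHom x) = π.toHom x⟩

variable {π ρ}

/-- If `π ≤ ρ`, the set `ρ.Pt` is a product of `π.Pt` and another set, along which matrices over
`π.Pt` act as block diagonal matrices. -/
theorem range_act_mono (h : π ≤ ρ) : (π.act (F := F)).range ≤ (ρ.act (F := F)).range := by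
  classical
  rintro _ ⟨m, rfl⟩
  refine ⟨Matrix.of fun y b => if y.1 - π.toHom y.1 = b.1 - π.toHom b.1 then
    m (π.proj y.1) (π.proj b.1) else 0, LinearMap.ext fun f => funext fun x => ?_⟩
  change ρ.act _ f x = π.act _ f x
  rw [act_apply, act_apply]
  simp only [Matrix.of_apply, ite_mul, zero_mul]
  rw [← Finset.sum_filter]
  symm
  refine Finset.sum_bij'
    (fun c _ => (⟨ρ.toHom x - π.toHom x + c.1, ?_⟩ : ρ.Pt)) (fun b _ => π.proj b.1) ?_ ?_ ?_ ?_ ?_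
  · rw [map_add, map_sub, ρ.idem, h.2, ← π.toHom_coe c, h.2]
  · intro c _
    refine Finset.mem_filter.mpr ⟨Finset.mem_univ _, ?_⟩
    change ρ.toHom x - π.toHom (ρ.toHom x) = ρ.toHom x - π.toHom x + c.1 -
      π.toHom (ρ.toHom x - π.toHom x + c.1)
    rw [h.1, map_add, map_sub, h.1, π.idem, toHom_coe]
    abel
  · simp
  · intro c _
    apply Pt.ext
    simp [proj, map_add, map_sub, h.1, π.idem, π.toHom_coe]
  · intro b hb
    simp only [proj, Finset.mem_filter, Finset.mem_univ, true_and, h.1] at hb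
    apply Pt.ext
    simp [proj, hb]
  · intro c _
    have h1 : π.proj (ρ.proj x).1 = π.proj x := Pt.ext (h.1 x)
    have h2 : π.proj (ρ.toHom x - π.toHom x + c.1) = c := Pt.ext (by
      simp [proj, map_add, map_sub, h.1, π.idem, π.toHom_coe])
    rw [h1, h2]
    congr 2
    change x - π.toHom x + c.1 = x - ρ.toHom x + (ρ.toHom x - π.toHom x + c.1)
    abel

/-- Matrix algebras of orthogonal retractions commute. -/
theorem commute_act (h₁ : ∀ x, π.toHom (ρ.toHom x) = 0) (h₂ : ∀ x, ρ.toHom (π.toHom x) = 0)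
    (m : Matrix π.Pt π.Pt F) (n : Matrix ρ.Pt ρ.Pt F) : Commute (π.act m) (ρ.act n) := by
  have hb : ∀ b : π.Pt, ρ.toHom b.1 = 0 := fun b => by rw [← π.toHom_coe b, h₂]
  have hc : ∀ c : ρ.Pt, π.toHom c.1 = 0 := fun c => by rw [← ρ.toHom_coe c, h₁]
  refine LinearMap.ext fun f => funext fun x => ?_
  simp only [Module.End.mul_apply, act_apply, proj, map_add, map_sub, h₁, h₂, hb, hc, sub_zero,
    add_zero, Finset.mul_sum]
  rw [Finset.sum_comm]
  refine Finset.sum_congr rfl fun c _ => Finset.sum_congr rfl fun b _ => ?_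
  rw [mul_left_comm]
  congr 3
  abel

/-- If `π` is the orthogonal sum of `π₁` and `π₂`, the operators in the image of `π` that commute
with the image of `π₂` lie in the image of `π₁`. -/
theorem mem_range_act_of_commute {π₁ π₂ : FiniteRetraction G}
    (h : ∀ x, π.toHom x = π₁.toHom x + π₂.toHom x) (h₁₂ : ∀ x, π₁.toHom (π₂.toHom x) = 0)
    (h₂₁ : ∀ x, π₂.toHom (π₁.toHom x) = 0) {T : Module.End F (G → F)}
    (hT : T ∈ (π.act (F := F)).range) (hcomm : ∀ m, Commute T (π₂.act m)) :
    T ∈ (π₁.act (F := F)).range := by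
  classical
  obtain ⟨m, rfl⟩ := hT
  have hle : ∀ b : π₁.Pt, π.toHom b.1 = b.1 := fun b => by
    rw [h, π₁.toHom_coe, ← π₁.toHom_coe b, h₂₁, π₁.toHom_coe, add_zero]
  refine ⟨Matrix.of fun y b => m ⟨y.1, hle y⟩ ⟨b.1, hle b⟩,
    LinearMap.ext fun f => funext fun x => ?_⟩
  change π₁.act _ f x = π.act m f x
  -- translate `f` by `c = π₂ x` with the matrix unit `E_{0,c}` and evaluate at `x - c`
  let c := π₂.proj x
  have key := congrFun (LinearMap.congr_fun (hcomm (Matrix.single (π₂.proj 0) c 1)) f) (x - c.1)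
  change π.act m (π₂.act _ f) (x - c.1) = π₂.act _ (π.act m f) (x - c.1) at key
  have hc : c.1 = π₂.toHom x := rfl
  have e1 : π₂.toHom (x - c.1) = 0 := by rw [map_sub, hc, π₂.idem, sub_self]
  have e2 : π.toHom (x - c.1) = π₁.toHom x := by
    rw [h, e1, map_sub, hc, h₁₂, sub_zero, add_zero]
  have e3 : π₂.proj 0 = π₂.proj (x - c.1) := Pt.ext (by simp [proj, e1])
  rw [act_single_apply, if_pos e3, e1, sub_zero, sub_add_cancel] at key
  rw [← key, act_apply, act_apply]
  have e4 : ∀ b : π.Pt,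
      π₂.act (Matrix.single (π₂.proj 0) c 1) f (x - c.1 - π.toHom (x - c.1) + b.1)
      = if π₂.toHom b.1 = 0 then f (x - π₁.toHom x + b.1) else 0 := by
    intro b
    have e5 : π₂.toHom (x - c.1 - π.toHom (x - c.1) + b.1) = π₂.toHom b.1 := by
      rw [e2, map_add, map_sub, e1, h₂₁]; simp
    rw [act_single_apply, e5]
    by_cases hb : π₂.toHom b.1 = 0
    · rw [if_pos hb, if_pos (Pt.ext ((map_zero _).trans (e5.trans hb).symm)), e2, hb]
      congr 1
      abel
    · rw [if_neg hb, if_neg]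
      intro h0
      have := congrArg Pt.val h0
      simp only [proj, map_zero, e5] at this
      exact hb this.symm
  simp only [e4, mul_ite, mul_zero]
  rw [← Finset.sum_filter]
  refine Finset.sum_bij' (fun b _ => (⟨b.1, hle b⟩ : π.Pt)) (fun b _ => π₁.proj b.1) ?_ ?_ ?_ ?_ ?_
  · intro b _
    simp only [Finset.mem_filter, Finset.mem_univ, true_and]
    rw [← π₁.toHom_coe b, h₂₁]
  · simp
  · intro b _
    exact π₁.proj_coe b
  · intro b hb
    simp only [Finset.mem_filter, Finset.mem_univ, true_and] at hb
    apply Pt.ext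
    change π₁.toHom b.1 = b.1
    conv_rhs => rw [← π.toHom_coe b, h, hb, add_zero]
  · intro b _
    have e6 : π.proj (x - c.1) = ⟨(π₁.proj x).1, hle _⟩ := Pt.ext e2
    rw [e6]
    rfl

/-- Operators in the image of `π` commute with the translations along the kernel of `π`. -/
theorem act_translate (m : Matrix π.Pt π.Pt F) (f : G → F) {g : G} (hg : π.toHom g = 0) (x : G) :
    π.act m (fun y => f (y + g)) x = π.act m f (x + g) := by
  have h : π.proj (x + g) = π.proj x := Pt.ext (by simp [proj, hg])
  rw [act_apply, act_apply, h, map_add, hg, add_zero]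
  refine Finset.sum_congr rfl fun b _ => ?_
  congr 2
  abel

end FiniteRetraction

end FiniteRetractions

/-! ### Directed unions of these matrix algebras -/

section UnionAlgebra

variable (F : Type u) [Field F] {G : Type u} [AddCommGroup G] {ι : Type u}

/-- The union of the matrix algebras attached to a family of finite retractions. -/
noncomputable def unionAlgebra (π : ι → FiniteRetraction G) :
    Subalgebra F (Module.End F (G → F)) :=
  ⨆ i, ((π i).act (F := F)).range

variable {F} {π : ι → FiniteRetraction G}

theorem directed_range_act (hπ : ∀ i j, ∃ k, π i ≤ π k ∧ π j ≤ π k) :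
    Directed (· ≤ ·) fun i => ((π i).act (F := F)).range := fun i j =>
  let ⟨k, h₁, h₂⟩ := hπ i j
  ⟨k, FiniteRetraction.range_act_mono h₁, FiniteRetraction.range_act_mono h₂⟩

variable (F π) in
/-- The inclusion of one of the matrix algebras in their union. -/
noncomputable def toUnionAlgebra (i : ι) :
    Matrix (π i).Pt (π i).Pt F →ₐ[F] unionAlgebra F π :=
  ((π i).act).codRestrict _ fun m =>
    (le_iSup (fun i => ((π i).act (F := F)).range) i : _ ≤ unionAlgebra F π) ⟨m, rfl⟩

theorem mem_range_toUnionAlgebra {i : ι} {x : unionAlgebra F π} :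
    x ∈ (toUnionAlgebra F π i).range ↔ x.1 ∈ ((π i).act (F := F)).range :=
  ⟨fun ⟨m, hm⟩ => ⟨m, congrArg Subtype.val hm⟩, fun ⟨m, hm⟩ => ⟨m, Subtype.ext hm⟩⟩

theorem mem_span_of_mem_range_act {i : ι} {x : unionAlgebra F π}
    (hx : x.1 ∈ ((π i).act (F := F)).range) :
    x ∈ Submodule.span F (Set.range fun ab : (π i).Pt × (π i).Pt =>
      toUnionAlgebra F π i (Matrix.single ab.1 ab.2 1)) := by
  obtain ⟨m, rfl⟩ := mem_range_toUnionAlgebra.mpr hx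
  change toUnionAlgebra F π i m ∈ _
  rw [Matrix.matrix_eq_sum_single m, map_sum]
  refine sum_mem fun a _ => ?_
  rw [map_sum]
  refine sum_mem fun b _ => ?_
  have : Matrix.single a b (m a b) = m a b • Matrix.single a b (1 : F) := by
    rw [Matrix.smul_single, smul_eq_mul, mul_one]
  rw [this, map_smul]
  exact Submodule.smul_mem _ _ (Submodule.subset_span ⟨(a, b), rfl⟩)

variable [Nonempty ι]

theorem mem_unionAlgebra_iff (hπ : ∀ i j, ∃ k, π i ≤ π k ∧ π j ≤ π k)
    {T : Module.End F (G → F)} : T ∈ unionAlgebra F π ↔ ∃ i, T ∈ ((π i).act (F := F)).range := by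
  rw [← SetLike.mem_coe, unionAlgebra, Subalgebra.coe_iSup_of_directed (directed_range_act hπ)]
  simp

theorem exists_finset_subset_range_act (hπ : ∀ i j, ∃ k, π i ≤ π k ∧ π j ≤ π k)
    (S : Finset (unionAlgebra F π)) : ∃ i, ∀ x ∈ S, x.1 ∈ ((π i).act (F := F)).range := by
  classical
  induction S using Finset.induction_on with
  | empty => exact ⟨Classical.arbitrary ι, by simp⟩
  | insert x S _ ih =>
    obtain ⟨i, hi⟩ := ih
    obtain ⟨j, hj⟩ := (mem_unionAlgebra_iff hπ).mp x.2
    obtain ⟨k, hik, hjk⟩ := hπ i j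
    refine ⟨k, fun y hy => ?_⟩
    rcases Finset.mem_insert.mp hy with rfl | hy
    · exact FiniteRetraction.range_act_mono hjk hj
    · exact FiniteRetraction.range_act_mono hik (hi y hy)

theorem isLocallyMatrix_unionAlgebra (hπ : ∀ i j, ∃ k, π i ≤ π k ∧ π j ≤ π k) :
    IsLocallyMatrix F (unionAlgebra F π) := by
  refine isLocallyMatrix_of_algHom fun S => ?_
  obtain ⟨i, hi⟩ := exists_finset_subset_range_act hπ S
  exact ⟨(π i).Pt, inferInstance, inferInstance, inferInstance, toUnionAlgebra F π i,
    fun x hx => mem_range_toUnionAlgebra.mpr (hi x hx)⟩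

/-- The Steinitz number of the union is the least common multiple of the degrees of its members. -/
theorem steinitz_unionAlgebra (hπ : ∀ i j, ∃ k, π i ≤ π k ∧ π j ≤ π k) (p : Nat.Primes) :
    (steinitz F (unionAlgebra F π)).exponent p =
      ⨆ i, ((Fintype.card (π i).Pt).factorization p : ℕ∞) := by
  classical
  apply le_antisymm
  · rw [steinitz_exponent_le_iff]
    intro n f
    let e : Fin n × Fin n → unionAlgebra F π := fun ij => f (Matrix.single ij.1 ij.2 1)
    obtain ⟨i, hi⟩ := exists_finset_subset_range_act hπ (Finset.univ.image e)
    have h0 : ∀ a b, (f (Matrix.single a b 1)).1 ∈ ((π i).act (F := F)).range := fun a b =>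
      hi _ (Finset.mem_image_of_mem e (Finset.mem_univ (a, b)))
    have h1 : ∀ a b, f (Matrix.single a b 1) ∈ (toUnionAlgebra F π i).range := fun a b =>
      mem_range_toUnionAlgebra.mpr (h0 a b)
    have hdvd : Fintype.card (Fin n) ∣ Fintype.card (π i).Pt := by
      apply Matrix.card_dvd_card_of_range_le (F := F) (A := unionAlgebra F π)
        (ι := (π i).Pt) (κ := Fin n) (toUnionAlgebra F π i) f
      exact h1
    rw [Fintype.card_fin] at hdvd
    refine le_trans ?_ (le_iSup _ i)
    have := (Nat.factorization_prime_le_iff_dvd n.ne_zero Fintype.card_ne_zero).mpr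
      hdvd p p.2
    exact_mod_cast this
  · exact iSup_le fun i => factorization_card_le_steinitz (toUnionAlgebra F π i) p

theorem rank_unionAlgebra_le (hπ : ∀ i j, ∃ k, π i ≤ π k ∧ π j ≤ π k) {α : Cardinal.{u}}
    (hα : Cardinal.aleph0 ≤ α) (hι : Cardinal.mk ι ≤ α) :
    Module.rank F (unionAlgebra F π) ≤ α := by
  let s : Set (unionAlgebra F π) := ⋃ i, Set.range fun ab : (π i).Pt × (π i).Pt =>
      toUnionAlgebra F π i (Matrix.single ab.1 ab.2 1)
  have hs : Submodule.span F s = ⊤ := by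
    refine top_le_iff.mp fun x _ => ?_
    obtain ⟨i, hi⟩ := (mem_unionAlgebra_iff hπ).mp x.2
    exact Submodule.span_mono (Set.subset_iUnion _ i) (mem_span_of_mem_range_act hi)
  rw [← rank_top F, ← hs]
  refine (rank_span_le s).trans ((Cardinal.mk_iUnion_le _).trans ?_)
  refine (mul_le_mul' hι (ciSup_le' fun i => ?_)).trans (Cardinal.mul_eq_self hα).le
  exact (Cardinal.mk_le_aleph0_iff.mpr (Set.countable_range _).to_subtype).trans hα

end UnionAlgebra

/-! ### Countably generated bicentralizers -/

section Bicentralizers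

/-- Every countable subset of `R` has a bicentralizer that is countably generated as a module over
the center of `R`. -/
def CountableBicentralizers (R : Type*) [Ring R] : Prop :=
  ∀ S : Set R, S.Countable → ∃ T : Set R, T.Countable ∧
    ∀ x ∈ S.centralizer.centralizer, x ∈ Submodule.span (Subring.center R) T

theorem CountableBicentralizers.matrix {R : Type*} [Ring R] (h : CountableBicentralizers R)
    (k : ℕ) : CountableBicentralizers (Matrix (Fin k) (Fin k) R) := by
  intro S hS
  obtain ⟨T, hT, hT'⟩ := h
    (⋃ ij : Fin k × Fin k, (fun x : Matrix (Fin k) (Fin k) R => x ij.1 ij.2) '' S)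
    (Set.countable_iUnion fun _ => hS.image _)
  refine ⟨⋃ ij : Fin k × Fin k, Matrix.single ij.1 ij.2 '' T,
    Set.countable_iUnion fun _ => hT.image _, fun x hx => ?_⟩
  rw [Matrix.matrix_eq_sum_single x]
  refine sum_mem fun i _ => sum_mem fun j _ => ?_
  have hij : x i j ∈ Submodule.span (Subring.center R) T := by
    apply hT'
    rw [Set.mem_centralizer_iff]
    intro c hc
    rw [Set.mem_centralizer_iff] at hc
    have hs : Matrix.scalar (Fin k) c ∈ S.centralizer := by
      rw [Set.mem_centralizer_iff]
      intro y hy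
      ext a b
      simpa using hc (y a b) (Set.mem_iUnion.mpr ⟨(a, b), y, hy, rfl⟩)
    have := congrFun (congrFun (Set.mem_centralizer_iff.mp hx _ hs) i) j
    simpa using this
  generalize x i j = y at hij ⊢
  induction hij using Submodule.span_induction with
  | mem a ha => exact Submodule.subset_span (Set.mem_iUnion.mpr ⟨(i, j), a, ha, rfl⟩)
  | zero => simp
  | add a b _ _ ha hb => rw [Matrix.single_add]; exact add_mem ha hb
  | smul c a _ ha =>
    have hc : Matrix.scalar (Fin k) (c : R) ∈ Subring.center (Matrix (Fin k) (Fin k) R) := by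
      rw [Subring.mem_center_iff]
      intro y
      ext a b
      simpa using Subring.mem_center_iff.mp c.2 (y a b)
    have : Matrix.single i j (c • a) =
        (⟨_, hc⟩ : Subring.center (Matrix (Fin k) (Fin k) R)) • Matrix.single i j a := by
      ext a b
      simp [Subring.smul_def, Matrix.single_apply]
    rw [this]
    exact Submodule.smul_mem _ _ ha

/-- For a subset `S` of the corner `e R e`, the bicentralizer of `S ∪ {e}` in `R` is to be
cut down by `e`. -/
theorem CountableBicentralizers.of_isCornerEmbedding {R C : Type*} [Ring R] [Ring C]
    (h : CountableBicentralizers R) {ψ : C →ₙ+* R} (hψ : IsCornerEmbedding ψ) :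
    CountableBicentralizers C := by
  intro S hS
  obtain ⟨T, hT, hT'⟩ := h (ψ '' insert 1 S) ((hS.insert 1).image ψ)
  have hone : ψ 1 * ψ 1 = ψ 1 := by rw [← map_mul, one_mul]
  have hleft : ∀ x, ψ 1 * ψ x = ψ x := fun x => by rw [← map_mul, one_mul]
  have hright : ∀ x, ψ x * ψ 1 = ψ x := fun x => by rw [← map_mul, mul_one]
  have hcut : ∀ r, ∃ c, ψ c = ψ 1 * r * ψ 1 := fun r => hψ.exists_eq _ (by
    simp only [← mul_assoc, hone]
    rw [mul_assoc _ (ψ 1), hone])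
  choose θ hθ using hcut
  have hθψ : ∀ c, θ (ψ c) = c := fun c => hψ.injective (by rw [hθ, hleft, hright])
  refine ⟨θ '' T, hT.image θ, fun x hx => ?_⟩
  have key : ∀ r ∈ Submodule.span (Subring.center R) T,
      θ r ∈ Submodule.span (Subring.center C) (θ '' T) := by
    intro r hr
    induction hr using Submodule.span_induction with
    | mem r hr => exact Submodule.subset_span ⟨r, hr, rfl⟩
    | zero =>
      have : θ 0 = 0 := hψ.injective (by rw [hθ]; simp)
      rw [this]; exact zero_mem _
    | add a b _ _ ha hb =>
      have : θ (a + b) = θ a + θ b := hψ.injective (by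
        rw [map_add, hθ, hθ, hθ, mul_add, add_mul])
      rw [this]; exact add_mem ha hb
    | smul z a _ ha =>
      have hz : ∀ r, r * (z : R) = z * r := Subring.mem_center_iff.mp z.2
      have hc : θ z ∈ Subring.center C := by
        rw [Subring.mem_center_iff]
        intro c
        apply hψ.injective
        rw [map_mul, map_mul, hθ]
        calc ψ c * (ψ 1 * z * ψ 1) = (ψ c * ψ 1) * (z * ψ 1) := by simp only [mul_assoc]
          _ = ψ c * z * ψ 1 := by rw [hright, mul_assoc]
          _ = z * ψ c * ψ 1 := by rw [hz]
          _ = z * (ψ 1 * ψ c) := by rw [mul_assoc, hright, hleft]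
          _ = ψ 1 * z * (ψ 1 * ψ c) := by rw [hz, hleft, mul_assoc, hleft]
          _ = _ := by simp only [mul_assoc]
      have : θ (z • a) = (⟨θ z, hc⟩ : Subring.center C) • θ a := by
        apply hψ.injective
        change ψ (θ (z * a)) = ψ (θ z * θ a)
        rw [map_mul, hθ, hθ, hθ]
        have h1 : ∀ y, ψ 1 * (ψ 1 * y) = ψ 1 * y := fun y => by rw [← mul_assoc, hone]
        have h2 : ∀ y, ψ 1 * (z * y) = z * (ψ 1 * y) := fun y => by
          rw [← mul_assoc, hz, mul_assoc]
        simp only [mul_assoc, h1, h2]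
      rw [this]
      exact Submodule.smul_mem _ _ ha
  rw [← hθψ x]
  apply key
  apply hT'
  rw [Set.mem_centralizer_iff]
  intro y hy
  rw [Set.mem_centralizer_iff] at hy
  have hy1 : ψ 1 * y = y * ψ 1 := hy _ ⟨1, Set.mem_insert _ _, rfl⟩
  have hyc : θ y ∈ S.centralizer := by
    rw [Set.mem_centralizer_iff]
    intro s hs
    apply hψ.injective
    have hs' : ψ s * y = y * ψ s := hy _ ⟨s, Set.mem_insert_of_mem _ hs, rfl⟩
    rw [map_mul, map_mul, hθ, hy1, mul_assoc, hone, ← mul_assoc, hs', mul_assoc, mul_assoc, hleft,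
      hright]
  have h3 := congrArg ψ (Set.mem_centralizer_iff.mp hx _ hyc)
  rw [map_mul, map_mul, hθ] at h3
  calc y * ψ x = ψ 1 * y * ψ 1 * ψ x := by
        rw [hy1, mul_assoc (y * ψ 1), hleft, mul_assoc, hleft]
    _ = ψ x * (ψ 1 * y * ψ 1) := h3
    _ = ψ x * y := by rw [hy1, mul_assoc, hone, ← hy1, ← mul_assoc, hright]

/-- Countable generation of bicentralizers is Morita invariant, as it passes to matrix rings and to
corners. -/
theorem CountableBicentralizers.of_moritaEquivalent {A B : Type u} [Ring A] [Ring B]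
    (h : CountableBicentralizers A) (hAB : MoritaEquivalent A B) : CountableBicentralizers B := by
  obtain ⟨E⟩ := hAB
  obtain ⟨k, ψ, hψ, -⟩ := exists_cornerEmbedding E
  exact (h.matrix k).of_isCornerEmbedding hψ

end Bicentralizers

/-! ### The algebra of coordinate retractions -/

section CoordinateRetractions

namespace FiniteRetraction

variable {ι : Type u} {n : ι → ℕ} [∀ i, NeZero (n i)]

open Classical in
variable (n) in
/-- The retraction of a product of finite cyclic groups onto finitely many of its factors. -/
noncomputable def coord (K : Finset ι) : FiniteRetraction (∀ i, ZMod (n i)) where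
  toHom :=
    { toFun := fun x i => if i ∈ K then x i else 0
      map_zero' := by ext; simp
      map_add' := fun x y => by ext i; by_cases h : i ∈ K <;> simp [h] }
  idem x := by ext i; by_cases h : i ∈ K <;> simp [h]
  finite := by
    refine (Set.finite_range fun (y : ∀ i : K, ZMod (n i)) (i : ι) =>
      if h : i ∈ K then y ⟨i, h⟩ else 0).subset ?_
    rintro _ ⟨x, rfl⟩
    exact ⟨fun i => x i, by ext i; by_cases h : i ∈ K <;> simp [h]⟩

open Classical in
theorem coord_apply (K : Finset ι) (x : ∀ i, ZMod (n i)) (i : ι) :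
    (coord n K).toHom x i = if i ∈ K then x i else 0 := rfl

theorem coord_coord_of_subset {K L : Finset ι} (h : K ⊆ L) (x : ∀ i, ZMod (n i)) :
    (coord n K).toHom ((coord n L).toHom x) = (coord n K).toHom x := by
  ext i
  by_cases hi : i ∈ K <;> simp [coord_apply, hi]
  exact fun h' => absurd (h hi) h'

theorem coord_mono {K L : Finset ι} (h : K ⊆ L) : coord n K ≤ coord n L := by
  refine ⟨coord_coord_of_subset h, fun x => ?_⟩
  ext i
  by_cases hi : i ∈ K <;> simp [coord_apply, hi]
  exact fun h' => absurd (h hi) h'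

theorem coord_directed (K L : Finset ι) : ∃ M, coord n K ≤ coord n M ∧ coord n L ≤ coord n M := by
  classical
  exact ⟨K ∪ L, coord_mono Finset.subset_union_left, coord_mono Finset.subset_union_right⟩

theorem coord_coord_of_disjoint {K L : Finset ι} (h : ∀ i ∈ K, i ∉ L) (x : ∀ i, ZMod (n i)) :
    (coord n K).toHom ((coord n L).toHom x) = 0 := by
  ext i
  by_cases hi : i ∈ K <;> simp [coord_apply, hi]
  exact fun h' => absurd h' (h i hi)

theorem card_coord (K : Finset ι) : Fintype.card (coord n K).Pt = ∏ i ∈ K, n i := by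
  classical
  let e : (coord n K).Pt ≃ ∀ i : K, ZMod (n i) :=
    { toFun := fun b i => b.1 i
      invFun := fun y => ⟨fun i => if h : i ∈ K then y ⟨i, h⟩ else 0, by
        ext i; by_cases h : i ∈ K <;> simp [coord_apply, h]⟩
      left_inv := fun b => by
        apply Pt.ext
        ext i
        have := congrFun b.2 i
        rw [coord_apply] at this
        by_cases h : i ∈ K
        · simp [h]
        · simpa [h] using this
      right_inv := fun y => by ext i; simp }
  rw [Fintype.card_congr e, Fintype.card_pi, ← Finset.prod_coe_sort K n]
  exact Finset.prod_congr rfl fun i _ => ZMod.card (n i)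

end FiniteRetraction

theorem mem_span_center_of_mem_span {F R : Type*} [Field F] [Ring R] [Algebra F R] {T : Set R}
    {x : R} (hx : x ∈ Submodule.span F T) : x ∈ Submodule.span (Subring.center R) T := by
  induction hx using Submodule.span_induction with
  | mem a ha => exact Submodule.subset_span ha
  | zero => exact zero_mem _
  | add a b _ _ ha hb => exact add_mem ha hb
  | smul c a _ ha =>
    have hc : algebraMap F R c ∈ Subring.center R :=
      Subring.mem_center_iff.mpr fun r => (Algebra.commutes c r).symm
    rw [Algebra.smul_def]
    exact Submodule.smul_mem _ (⟨_, hc⟩ : Subring.center R) ha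

open FiniteRetraction in
/-- In the algebra of all coordinate retractions, the bicentralizer of a set `S` of operators
depends only on the coordinates that occur in `S`. -/
theorem countableBicentralizers_coord (F : Type u) [Field F] {ι : Type u} (n : ι → ℕ)
    [∀ i, NeZero (n i)] : CountableBicentralizers (unionAlgebra F (coord n)) := by
  classical
  intro S hS
  have hmem : ∀ s : unionAlgebra F (coord n), ∃ K, s.1 ∈ ((coord n K).act (F := F)).range :=
    fun s => (mem_unionAlgebra_iff coord_directed).mp s.2
  choose κ hκ using hmem
  let J : Set ι := ⋃ s ∈ S, (κ s : Set ι)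
  have hJ : J.Countable := hS.biUnion fun s _ => (κ s).countable_toSet
  have := hJ.to_subtype
  let T : Set (unionAlgebra F (coord n)) :=
    ⋃ K : Finset J, Set.range fun ab : (coord n (K.map (.subtype _))).Pt × _ =>
      toUnionAlgebra F (coord n) (K.map (.subtype _)) (Matrix.single ab.1 ab.2 1)
  refine ⟨T, Set.countable_iUnion fun K => Set.countable_range _, fun x hx => ?_⟩
  let K₁ := (κ x).filter (· ∈ J)
  let K₂ := (κ x).filter (· ∉ J)
  have hdis : ∀ i ∈ K₁, i ∉ K₂ := fun i h₁ h₂ =>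
    (Finset.mem_filter.mp h₂).2 (Finset.mem_filter.mp h₁).2
  have hx₁ : x.1 ∈ ((coord n K₁).act (F := F)).range := by
    refine mem_range_act_of_commute (π := coord n (κ x)) (π₂ := coord n K₂) (fun y => ?_)
      (coord_coord_of_disjoint hdis)
      (coord_coord_of_disjoint fun i h₂ h₁ => hdis i h₁ h₂) (hκ x) fun m => ?_
    · ext i
      by_cases h₁ : i ∈ κ x <;> by_cases h₂ : i ∈ J <;> simp [coord_apply, K₁, K₂, h₁, h₂]
    · have hm : toUnionAlgebra F (coord n) K₂ m ∈ S.centralizer := by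
        rw [Set.mem_centralizer_iff]
        intro s hs
        obtain ⟨t, ht⟩ := hκ s
        have hsJ : ∀ i ∈ κ s, i ∉ K₂ := fun i hi h₂ =>
          (Finset.mem_filter.mp h₂).2 (Set.mem_biUnion hs hi)
        have := commute_act (F := F) (coord_coord_of_disjoint hsJ)
          (coord_coord_of_disjoint fun i h₂ h₁ => hsJ i h₁ h₂) t m
        apply Subtype.ext
        change s.1 * (coord n K₂).act m = (coord n K₂).act m * s.1
        rw [← ht]
        exact this
      exact (congrArg Subtype.val (Set.mem_centralizer_iff.mp hx _ hm)).symm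
  have hK₁ : (K₁.subtype (· ∈ J)).map (.subtype _) = K₁ :=
    Finset.subtype_map_of_mem fun i hi => (Finset.mem_filter.mp hi).2
  have hspan : x ∈ Submodule.span F T := by
    rw [← hK₁] at hx₁
    exact Submodule.span_mono (Set.subset_iUnion_of_subset (K₁.subtype (· ∈ J)) subset_rfl)
      (mem_span_of_mem_range_act hx₁)
  exact mem_span_center_of_mem_span hspan

section Factors

variable (s : SteinitzNumber) (p : Nat.Primes) {β : Type u}

open Classical in
/-- A family of primes and ones with product `s` if `s` has exponent `∞` at `p`: every prime `ℓ`
occurs as often as the exponent of `s` at `ℓ` says, and `p` once more for each element of `β`. The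
index type can thus be made as large as desired. -/
noncomputable def primeFamily (β : Type u) : (Nat.Primes × ℕ) ⊕ β → ℕ
  | .inl (ℓ, k) => if (k : ℕ∞) < s.exponent ℓ then ℓ else 1
  | .inr _ => p

instance (i) : NeZero (primeFamily s p β i) := ⟨by
  rcases i with ⟨ℓ, k⟩ | b
  · by_cases h : (k : ℕ∞) < s.exponent ℓ
    · simpa [primeFamily, h] using ℓ.2.ne_zero
    · simp [primeFamily, h]
  · exact p.2.ne_zero⟩

variable {s p} in
/-- The additional factors `p` are absorbed by the exponent `∞` at `p`. -/
theorem factorization_primeFamily_le (hp : s.exponent p = ⊤)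
    (K : Finset ((Nat.Primes × ℕ) ⊕ β)) (k : ℕ) (ℓ : Nat.Primes) :
    (((∏ i ∈ K, primeFamily s p β i) * p ^ k).factorization ℓ : ℕ∞) ≤ s.exponent ℓ := by
  classical
  by_cases hℓ : ℓ = p
  · rw [hℓ, hp]; exact le_top
  have hpℓ : (p : ℕ).factorization ℓ = 0 :=
    Nat.factorization_eq_zero_of_not_dvd fun h =>
      hℓ (Subtype.ext ((Nat.prime_dvd_prime_iff_eq ℓ.2 p.2).mp h))
  rw [Nat.factorization_mul (Finset.prod_ne_zero_iff.mpr fun i _ => NeZero.ne _)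
    (pow_ne_zero _ p.2.ne_zero), Nat.factorization_prod fun i _ => NeZero.ne _,
    Nat.factorization_pow]
  simp only [Finsupp.coe_add, Pi.add_apply, Finsupp.coe_smul, Pi.smul_apply, hpℓ, smul_zero,
    add_zero, Finsupp.finsetSum_apply]
  cases hr : s.exponent ℓ with
  | top => exact le_top
  | coe r =>
    refine Nat.cast_le.mpr ?_
    have hterm : ∀ i ∈ K, (primeFamily s p β i).factorization ℓ ≤
        if i ∈ (Finset.range r).image (fun k => Sum.inl (ℓ, k)) then 1 else 0 := by
      rintro (⟨q, k⟩ | b) -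
      · by_cases hq : q = ℓ
        · subst hq
          by_cases hk : k < r <;> simp [primeFamily, hr, hk, q.2.factorization]
        · have : (q : ℕ).factorization ℓ = 0 :=
            Nat.factorization_eq_zero_of_not_dvd fun h =>
              hq (Subtype.ext ((Nat.prime_dvd_prime_iff_eq ℓ.2 q.2).mp h)).symm
          by_cases hk : (k : ℕ∞) < s.exponent q <;> simp [primeFamily, hk, this]
      · exact hpℓ.le.trans (Nat.zero_le _)
    refine (Finset.sum_le_sum hterm).trans ?_
    rw [← Finset.sum_filter, Finset.sum_const, smul_eq_mul, mul_one]
    refine (Finset.card_le_card fun i hi => (Finset.mem_filter.mp hi).2).trans ?_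
    exact Finset.card_image_le.trans (Finset.card_range r).le

theorem exists_prod_primeFamily (ℓ : Nat.Primes) {m : ℕ} (hm : (m : ℕ∞) ≤ s.exponent ℓ) :
    ∃ K : Finset ((Nat.Primes × ℕ) ⊕ β), ∏ i ∈ K, primeFamily s p β i = ℓ ^ m := by
  classical
  refine ⟨(Finset.range m).image fun k => Sum.inl (ℓ, k), ?_⟩
  rw [Finset.prod_image fun a _ b _ h => by simpa using h]
  rw [Finset.prod_congr rfl fun k hk => ?_, Finset.prod_const, Finset.card_range]
  exact if_pos ((Nat.cast_lt.mpr (Finset.mem_range.mp hk)).trans_le hm)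

end Factors

variable {F : Type u} [Field F] {G : Type u} [AddCommGroup G] {ι β : Type u}
  {π : ι → FiniteRetraction G}

theorem steinitz_unionAlgebra_eq [Nonempty ι] (hπ : ∀ i j, ∃ k, π i ≤ π k ∧ π j ≤ π k)
    {s : SteinitzNumber} {p : Nat.Primes} (hp : s.exponent p = ⊤)
    (hle : ∀ i, ∃ (K : Finset ((Nat.Primes × ℕ) ⊕ β)) (k : ℕ),
      Fintype.card (π i).Pt = (∏ i ∈ K, primeFamily s p β i) * p ^ k)
    (hge : ∀ K : Finset ((Nat.Primes × ℕ) ⊕ β), ∃ i,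
      ∏ i ∈ K, primeFamily s p β i ∣ Fintype.card (π i).Pt) :
    steinitz F (unionAlgebra F π) = s := by
  ext ℓ : 2
  rw [steinitz_unionAlgebra hπ]
  apply le_antisymm
  · refine iSup_le fun i => ?_
    obtain ⟨K, k, h⟩ := hle i
    rw [h]
    exact factorization_primeFamily_le hp K k ℓ
  · refine ENat.forall_natCast_le_iff_le.mp fun m hm => ?_
    obtain ⟨K, hK⟩ := exists_prod_primeFamily s p (β := β) ℓ hm
    obtain ⟨i, hi⟩ := hge K
    rw [hK] at hi
    refine le_iSup_of_le i (Nat.cast_le.mpr ?_)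
    exact (ℓ.2.pow_dvd_iff_le_factorization Fintype.card_ne_zero).mp hi

/-- Functions dual to a family of points give linearly independent multiplication operators. -/
theorem le_rank_unionAlgebra [DecidableEq β] (h : β → G → F) (g : β → G)
    (hmem : ∀ b, mulOp (h b) ∈ unionAlgebra F π) (hg : ∀ b c, h b (g c) = if b = c then 1 else 0) :
    Cardinal.mk β ≤ Module.rank F (unionAlgebra F π) := by
  let ev : β → Module.Dual F (unionAlgebra F π) := fun b =>
    (LinearMap.proj (g b)).comp
      ((LinearMap.applyₗ (1 : G → F)).comp (unionAlgebra F π).val.toLinearMap)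
  have hev : ∀ b c, ev b ⟨_, hmem c⟩ = if c = b then 1 else 0 := fun b c => by
    change mulOp (h c) 1 (g b) = _
    rw [mulOp_apply, hg, Pi.one_apply, mul_one]
  refine (LinearIndependent.of_pairwise_dual_eq_zero_one
    (fun b => (⟨_, hmem b⟩ : unionAlgebra F π)) ev (fun b c hbc => ?_) fun b => ?_).cardinal_le_rank
  · exact (hev b c).trans (if_neg hbc.symm)
  · exact (hev b b).trans (if_pos rfl)

end CoordinateRetractions

/-! ### Dual pairs over a finite field -/

section DualPairs

/-- A dual pair of vector spaces over a finite field has enough finite-dimensional direct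
decompositions. -/
theorem exists_projection_of_dualPair {K V : Type*} [Field K] [Finite K] [AddCommGroup V]
    [Module K V] (W : Submodule K (Module.Dual K V)) (hW : ∀ v, v ≠ 0 → ∃ w ∈ W, w v ≠ 0)
    (w₀ : Set (Module.Dual K V)) (hw₀ : w₀.Finite) (hw₀W : w₀ ⊆ W) (v₀ : Set V) (hv₀ : v₀.Finite) :
    ∃ q : V →ₗ[K] V, (∀ v, q (q v) = q v) ∧ (Set.range q).Finite ∧ (∀ w ∈ w₀, w ∘ₗ q = w) ∧
      (∀ v ∈ v₀, q v = v) ∧ ∀ f : Module.Dual K V, f ∘ₗ q ∈ W := by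
  choose! θ hθW hθ using hW
  have := Module.Finite.span_of_finite K hv₀
  have hV₁ : Finite (Submodule.span K v₀) := Module.finite_of_finite K
  -- the functionals separating the points of the finite space spanned by `v₀`
  let L : Set (Module.Dual K V) := w₀ ∪ θ '' ((Submodule.span K v₀ : Set V) \ {0})
  have hL : L.Finite := hw₀.union ((Set.Finite.sdiff (Set.toFinite _)).image θ)
  have hLW : L ⊆ W := by
    rintro w (hw | ⟨v, hv, rfl⟩)
    exacts [hw₀W hw, hθW v hv.2]
  have := hL.to_subtype
  let N : Submodule K V := ⨅ w : L, LinearMap.ker w.1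
  have hN : ∀ v ∈ N, ∀ w ∈ L, w v = 0 := fun v hv w hw =>
    LinearMap.mem_ker.mp ((Submodule.mem_iInf _).mp hv ⟨w, hw⟩)
  have hdis : Disjoint (Submodule.span K v₀) N := by
    rw [Submodule.disjoint_def]
    intro v hv hvN
    by_contra h0
    exact hθ v h0 (hN v hvN _ (Or.inr ⟨v, ⟨hv, h0⟩, rfl⟩))
  obtain ⟨V₀, hle, hV₀⟩ := hdis.exists_isCompl
  have hwq : ∀ w ∈ L, w ∘ₗ V₀.projection N hV₀ = w := fun w hw => by
    ext v
    have := hN _ (Submodule.sub_projection_mem hV₀ v) w hw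
    rw [map_sub, sub_eq_zero] at this
    exact this.symm
  refine ⟨V₀.projection N hV₀, fun v => ?_, ?_, fun w hw => hwq w (Or.inl hw), fun v hv => ?_,
    fun f => ?_⟩
  · exact Submodule.projection_apply_of_mem_left _ (Submodule.projection_apply_mem _ _)
  · -- the values of the functionals in `L` determine the projection
    refine Set.Finite.of_finite_image (f := fun v (w : L) => w.1 v) (Set.toFinite _) ?_
    rintro _ ⟨v, rfl⟩ _ ⟨v', rfl⟩ h
    have hmem : V₀.projection N hV₀ v - V₀.projection N hV₀ v' ∈ N :=
      (Submodule.mem_iInf _).mpr fun w => LinearMap.mem_ker.mpr (by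
        rw [map_sub, sub_eq_zero]; exact congrFun h w)
    exact sub_eq_zero.mp (Submodule.disjoint_def.mp hV₀.disjoint _
      (sub_mem (Submodule.projection_apply_mem _ _) (Submodule.projection_apply_mem _ _)) hmem)
  · exact Submodule.projection_apply_of_mem_left _ (hle (Submodule.subset_span hv))
  · have : f ∘ₗ V₀.projection N hV₀ ∈ Submodule.span K (Set.range fun w : L => w.1) := by
      refine mem_span_of_iInf_ker_le_ker fun v hv => ?_
      rw [LinearMap.mem_ker, LinearMap.comp_apply,
        (Submodule.projection_apply_eq_zero_iff hV₀).mpr hv, map_zero]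
    refine Submodule.span_le.mpr ?_ this
    rintro _ ⟨w, rfl⟩
    exact hLW w.2

variable {p : ℕ} [Fact p.Prime] {V : Type u} [AddCommGroup V] [Module (ZMod p) V]

/-- A linear idempotent with finite range, as a finite retraction. -/
def FiniteRetraction.ofLinearMap (q : V →ₗ[ZMod p] V) (hq : ∀ v, q (q v) = q v)
    (hfin : (Set.range q).Finite) : FiniteRetraction V :=
  ⟨q.toAddMonoidHom, hq, hfin⟩

theorem FiniteRetraction.card_ofLinearMap (q : V →ₗ[ZMod p] V) (hq : ∀ v, q (q v) = q v)
    (hfin : (Set.range q).Finite) : ∃ k, Fintype.card (ofLinearMap q hq hfin).Pt = p ^ k := by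
  have : Finite (LinearMap.range q) := hfin.to_subtype
  let e : (ofLinearMap q hq hfin).Pt ≃ LinearMap.range q :=
    { toFun := fun b => ⟨b.1, b.1, b.2⟩
      invFun := fun v => ⟨v.1, by obtain ⟨_, w, rfl⟩ := v; exact hq w⟩
      left_inv := fun _ => rfl
      right_inv := fun _ => rfl }
  refine ⟨Module.finrank (ZMod p) (LinearMap.range q), ?_⟩
  rw [← Nat.card_eq_fintype_card, Nat.card_congr e, Module.natCard_eq_pow_finrank (K := ZMod p),
    Nat.card_zmod]

/-- The dual of a space of countably infinite dimension has separating subspaces of every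
sufficiently small uncountable size. -/
theorem exists_uncountable_separating (p : ℕ) [Fact p.Prime] {α : Cardinal.{u}}
    (hα : Cardinal.aleph0 < α) :
    ∃ W : Submodule (ZMod p) (Module.Dual (ZMod p) (ULift.{u} ℕ →₀ ZMod p)),
      ¬ (W : Set (Module.Dual (ZMod p) (ULift.{u} ℕ →₀ ZMod p))).Countable ∧ Cardinal.mk W ≤ α ∧
      ∀ i, Finsupp.lapply i ∈ W := by
  classical
  let D := Module.Dual (ZMod p) (ULift.{u} ℕ →₀ ZMod p)
  have hunc : ¬ Countable D := by
    intro h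
    let f : Set (ULift.{u} ℕ) → D := fun s =>
      Finsupp.linearCombination (ZMod p) (s.indicator (1 : ULift.{u} ℕ → ZMod p))
    have hval : ∀ s i, f s (Finsupp.single i 1) = s.indicator 1 i := fun s i =>
      (Finsupp.linearCombination_single ..).trans (one_smul ..)
    have hf : Function.Injective f := fun s t hst => by
      ext i
      have h1 := LinearMap.congr_fun hst (Finsupp.single i 1)
      rw [hval, hval] at h1
      by_cases hs : i ∈ s <;> by_cases ht : i ∈ t <;> simp [hs, ht] at h1 ⊢
    have := hf.countable
    have h2 := Cardinal.mk_le_aleph0_iff.mpr this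
    rw [Cardinal.mk_set] at h2
    refine (Cardinal.cantor (Cardinal.mk (ULift.{u} ℕ))).not_ge (h2.trans ?_)
    simp
  obtain ⟨X, hX, hXα⟩ : ∃ X : Set D, ¬ X.Countable ∧ Cardinal.mk X ≤ α := by
    rcases le_total (Cardinal.mk D) α with h | h
    · exact ⟨Set.univ, fun h' => hunc (Set.countable_univ_iff.mp h'), by rwa [Cardinal.mk_univ]⟩
    · obtain ⟨X, hX⟩ := Cardinal.le_mk_iff_exists_set.mp h
      exact ⟨X, fun h' => (hα.trans_eq hX.symm).not_ge
        (Cardinal.le_aleph0_iff_set_countable.mpr h'), hX.le⟩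
  let Y : Set D := X ∪ Set.range fun i : ULift.{u} ℕ => Finsupp.lapply i
  have hYα : Cardinal.mk Y ≤ α := by
    refine (Cardinal.mk_union_le _ _).trans (Cardinal.add_le_of_le hα.le hXα (le_trans ?_ hα.le))
    exact Cardinal.mk_le_aleph0_iff.mpr (Set.countable_range _).to_subtype
  have hY : Infinite Y := by
    rw [← not_finite_iff_infinite]
    intro h
    exact hX ((Set.toFinite Y).subset Set.subset_union_left).countable
  refine ⟨Submodule.span (ZMod p) Y, fun h => hX (h.mono ?_), ?_, fun i => ?_⟩
  · exact Set.subset_union_left.trans Submodule.subset_span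
  · have hsurj : Function.Surjective fun c : Y →₀ ZMod p =>
        (⟨Finsupp.linearCombination (ZMod p) (fun y : Y => y.1) c, by
          rw [Finsupp.mem_span_iff_linearCombination]; exact ⟨c, rfl⟩⟩ :
          Submodule.span (ZMod p) Y) := fun w => by
      obtain ⟨c, hc⟩ := (Finsupp.mem_span_iff_linearCombination _ _ _).mp w.2
      exact ⟨c, Subtype.ext hc⟩
    refine (Cardinal.mk_le_of_surjective hsurj).trans ?_
    rw [Cardinal.mk_finsupp_lift_of_infinite, Cardinal.lift_id'.{0, u}]
    refine max_le hYα (le_trans ?_ hα.le)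
    rw [Cardinal.lift_le_aleph0]
    exact Cardinal.mk_le_aleph0
  · exact Submodule.subset_span (Or.inr ⟨i, rfl⟩)

/-- A directed system of finite retractions of an abelian group `V`, with an uncountable set of
functionals. Each functional is compatible with some retraction `q` of the system, that is, factors
through `q`; each `q` is compatible with finitely many of them; yet countably many functionals
separate the points of `V`. -/
structure RetractionSystem (p : ℕ) (V κ : Type u) [AddCommGroup V] where
  /-- The finite retractions. -/
  ret : κ → FiniteRetraction V
  directed : ∀ i j, ∃ k, ret i ≤ ret k ∧ ret j ≤ ret k
  card_pt : ∀ i, ∃ k, Fintype.card (ret i).Pt = p ^ k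
  /-- The uncountable set of functionals. -/
  functionals : Set (V →+ ZMod p)
  exists_compatible : ∀ w ∈ functionals, ∃ i, ∀ v, w ((ret i).toHom v) = w v
  finite_compatible : ∀ i, {w ∈ functionals | ∀ v, w ((ret i).toHom v) = w v}.Finite
  uncountable : ¬ functionals.Countable
  /-- The countable separating set of functionals. -/
  separating : Set (V →+ ZMod p)
  separating_subset : separating ⊆ functionals
  countable_separating : separating.Countable
  eq_of_separating : ∀ v v', (∀ w ∈ separating, w v = w v') → v = v'

theorem exists_retractionSystem (p : ℕ) [Fact p.Prime] {α : Cardinal.{u}}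
    (hα : Cardinal.aleph0 < α) :
    ∃ (V κ : Type u) (_ : AddCommGroup V) (_ : RetractionSystem p V κ), Nonempty κ ∧
      Cardinal.mk κ ≤ α := by
  classical
  obtain ⟨W, hWc, hWα, hcoord⟩ := exists_uncountable_separating p hα
  let V := ULift.{u} ℕ →₀ ZMod p
  have hsep : ∀ v : V, v ≠ 0 → ∃ w ∈ W, w v ≠ 0 := fun v hv => by
    obtain ⟨i, hi⟩ := Finsupp.ne_iff.mp hv
    exact ⟨_, hcoord i, hi⟩
  let κ := Finset W × Finset V
  have hex := fun k : κ => exists_projection_of_dualPair W hsep ((↑) '' (k.1 : Set W))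
    (k.1.finite_toSet.image _) (by rintro _ ⟨w, -, rfl⟩; exact w.2) (k.2 : Set V) k.2.finite_toSet
  choose q hq hfin hqw hqv hqW using hex
  let ret : κ → FiniteRetraction V := fun k => .ofLinearMap (q k) (hq k) (hfin k)
  have hret : ∀ k v, (ret k).toHom v = q k v := fun _ _ => rfl
  -- the functionals that factor through a finite projection form a finite dual space
  have hfun : ∀ k : κ, {w : Module.Dual (ZMod p) V | w ∘ₗ q k = w}.Finite := fun k => by
    have := (hfin k).to_subtype
    refine Set.Finite.of_finite_image (f := fun w (v : Set.range (q k)) => w v.1)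
      (Set.toFinite _) ?_
    intro w hw w' hw' h
    rw [← hw, ← hw']
    exact LinearMap.ext fun v => congrFun h ⟨q k v, v, rfl⟩
  have hle : ∀ i k : κ, (∀ w : Module.Dual (ZMod p) V, w ∘ₗ q i = w → w ∘ₗ q k = w) →
      (∀ v, q i v = v → q k v = v) →
      ret i ≤ ret k := by
    intro i k h₁ h₂
    refine ⟨fun v => ?_, fun v => h₂ _ (hq i v)⟩
    -- the functionals separate the two sides
    change q i (q k v) = q i v
    refine Finsupp.ext fun n => ?_
    have := h₁ (Finsupp.lapply n ∘ₗ q i)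
      (LinearMap.ext fun v => congrArg (fun v : V => v n) (hq i v))
    exact LinearMap.congr_fun this v
  let toHoms : Module.Dual (ZMod p) V → V →+ ZMod p := fun w => w.toAddMonoidHom
  have hinj : Function.Injective toHoms := fun w w' h =>
    LinearMap.ext fun v => DFunLike.congr_fun h v
  refine ⟨V, κ, inferInstance,
    { ret := ret
      directed := fun i j => ?_
      card_pt := fun i => FiniteRetraction.card_ofLinearMap _ _ _
      functionals := toHoms '' W
      exists_compatible := ?_
      finite_compatible := fun i => ?_
      uncountable := fun h => hWc (Set.countable_of_injective_of_countable_image hinj.injOn h)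
      separating := Set.range fun n => toHoms (Finsupp.lapply n)
      separating_subset := ?_
      countable_separating := Set.countable_range _
      eq_of_separating := fun v v' h => Finsupp.ext fun n => h _ ⟨n, rfl⟩ }, inferInstance, ?_⟩
  · let w₁ := (hfun i).toFinset ∪ (hfun j).toFinset
    let v₁ := (hfin i).toFinset ∪ (hfin j).toFinset
    have hw₁ : ∀ w ∈ w₁, w ∈ W := by
      intro w hw
      rcases Finset.mem_union.mp hw with h | h
      · rw [← (hfun i).mem_toFinset.mp h]; exact hqW i w
      · rw [← (hfun j).mem_toFinset.mp h]; exact hqW j w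
    let k : κ := (w₁.subtype (· ∈ W), v₁)
    have hk₁ : ∀ w ∈ w₁, w ∘ₗ q k = w := fun w hw =>
      hqw k w ⟨⟨w, hw₁ w hw⟩, Finset.mem_subtype.mpr hw, rfl⟩
    have hk₂ : ∀ v ∈ v₁, q k v = v := fun v hv => hqv k v hv
    refine ⟨k, hle i k (fun w hw => hk₁ w ?_) fun v hv => hk₂ v ?_,
      hle j k (fun w hw => hk₁ w ?_) fun v hv => hk₂ v ?_⟩
    · exact Finset.mem_union_left _ ((hfun i).mem_toFinset.mpr hw)
    · exact Finset.mem_union_left _ ((hfin i).mem_toFinset.mpr ⟨v, hv⟩)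
    · exact Finset.mem_union_right _ ((hfun j).mem_toFinset.mpr hw)
    · exact Finset.mem_union_right _ ((hfin j).mem_toFinset.mpr ⟨v, hv⟩)
  · rintro _ ⟨w, hw, rfl⟩
    let k : κ := ({⟨w, hw⟩}, ∅)
    exact ⟨k, LinearMap.congr_fun (hqw k w ⟨⟨w, hw⟩, Finset.mem_singleton_self _, rfl⟩)⟩
  · refine ((hfun i).image toHoms).subset ?_
    rintro _ ⟨⟨w, -, rfl⟩, h⟩
    exact ⟨w, LinearMap.ext h, rfl⟩
  · rintro _ ⟨n, rfl⟩
    exact ⟨_, hcoord n, rfl⟩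
  · have : Infinite W := by
      rw [← not_finite_iff_infinite]
      intro h
      exact hWc (Set.toFinite (W : Set (Module.Dual (ZMod p) V))).countable
    rw [Cardinal.mk_prod, Cardinal.lift_id, Cardinal.lift_id, Cardinal.mk_finset_of_infinite]
    refine (mul_le_mul' hWα (le_trans ?_ hα.le)).trans (Cardinal.mul_eq_self hα.le).le
    exact Cardinal.mk_le_aleph0

end DualPairs

/-! ### An algebra with a large bicentralizer -/

section LargeBicentralizers

namespace FiniteRetraction

variable {G H : Type u} [AddCommGroup G] [AddCommGroup H]

/-- The product of two finite retractions. -/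
def prod (π : FiniteRetraction G) (ρ : FiniteRetraction H) : FiniteRetraction (G × H) where
  toHom := π.toHom.prodMap ρ.toHom
  idem x := Prod.ext (π.idem x.1) (ρ.idem x.2)
  finite := (π.finite.prod ρ.finite).subset <| by
    rintro _ ⟨x, rfl⟩
    exact ⟨⟨x.1, rfl⟩, ⟨x.2, rfl⟩⟩

theorem card_prod (π : FiniteRetraction G) (ρ : FiniteRetraction H) :
    Fintype.card (π.prod ρ).Pt = Fintype.card π.Pt * Fintype.card ρ.Pt := by
  let e : (π.prod ρ).Pt ≃ π.Pt × ρ.Pt :=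
    { toFun := fun b => (⟨b.1.1, congrArg Prod.fst b.2⟩, ⟨b.1.2, congrArg Prod.snd b.2⟩)
      invFun := fun b => ⟨(b.1.1, b.2.1), Prod.ext b.1.2 b.2.2⟩
      left_inv := fun _ => rfl
      right_inv := fun _ => rfl }
  rw [Fintype.card_congr e, Fintype.card_prod]

theorem prod_mono {π π' : FiniteRetraction G} {ρ ρ' : FiniteRetraction H} (h : π ≤ π')
    (h' : ρ ≤ ρ') : π.prod ρ ≤ π'.prod ρ' :=
  ⟨fun x => Prod.ext (h.1 x.1) (h'.1 x.2), fun x => Prod.ext (h.2 x.1) (h'.2 x.2)⟩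

/-- Multiplication by `h` commutes with a matrix if and only if the matrix connects only points with
the same value of `h`. -/
theorem commute_act_mulOp_iff {F : Type u} [Field F] (π : FiniteRetraction G)
    (m : Matrix π.Pt π.Pt F) (h : G → F) :
    Commute (π.act m) (mulOp h) ↔
      ∀ x b, m (π.proj x) b ≠ 0 → h (x - π.toHom x + b.1) = h x := by
  classical
  constructor
  · intro hc x b hm
    -- evaluate at the indicator function of the point in question
    have key := congrFun (LinearMap.congr_fun hc (Pi.single (x - π.toHom x + b.1) 1)) x
    change π.act m (mulOp h _) x = mulOp h (π.act m _) x at key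
    rw [mulOp_apply, act_apply, act_apply, Finset.sum_eq_single b, Finset.sum_eq_single b] at key
    · rw [mulOp_apply, Pi.single_eq_same, mul_one, mul_one, mul_comm] at key
      exact mul_right_cancel₀ hm key
    · intro c _ hcb
      rw [Pi.single_eq_of_ne fun h => hcb (Pt.ext (add_left_cancel h)), mul_zero]
    · simp
    · intro c _ hcb
      rw [mulOp_apply, Pi.single_eq_of_ne fun h => hcb (Pt.ext (add_left_cancel h)), mul_zero,
        mul_zero]
    · simp
  · intro hm
    refine LinearMap.ext fun f => funext fun x => ?_
    change π.act m (mulOp h f) x = mulOp h (π.act m f) x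
    rw [mulOp_apply, act_apply, act_apply, Finset.mul_sum]
    refine Finset.sum_congr rfl fun b _ => ?_
    rw [mulOp_apply]
    by_cases h0 : m (π.proj x) b = 0
    · simp [h0]
    · rw [hm x b h0, mul_left_comm]

end FiniteRetraction

open FiniteRetraction

variable {G V ι κ : Type u} [AddCommGroup G] [AddCommGroup V]

/-- The products of the members of two families of retractions. -/
def prodFamily (π : ι → FiniteRetraction G) (ρ : κ → FiniteRetraction V) (i : ι × κ) :
    FiniteRetraction (G × V) := (π i.1).prod (ρ i.2)

theorem prodFamily_directed {π : ι → FiniteRetraction G} {ρ : κ → FiniteRetraction V}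
    (hπ : ∀ i j, ∃ k, π i ≤ π k ∧ π j ≤ π k) (hρ : ∀ i j, ∃ k, ρ i ≤ ρ k ∧ ρ j ≤ ρ k) (i j) :
    ∃ k, prodFamily π ρ i ≤ prodFamily π ρ k ∧ prodFamily π ρ j ≤ prodFamily π ρ k := by
  obtain ⟨k, h₁, h₂⟩ := hπ i.1 j.1
  obtain ⟨l, h₃, h₄⟩ := hρ i.2 j.2
  exact ⟨(k, l), prod_mono h₁ h₃, prod_mono h₂ h₄⟩

variable {F : Type u} [Field F] [Nonempty ι] [Nonempty κ]

/-- The center being `F`, the span of a countable set over the center lies in the union of countably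
many of the matrix algebras. -/
theorem exists_countable_index {π : ι → FiniteRetraction G}
    (hπ : ∀ i j, ∃ k, π i ≤ π k ∧ π j ≤ π k) {T : Set (unionAlgebra F π)} (hT : T.Countable) :
    ∃ I : Set ι, I.Countable ∧ ∀ x ∈ Submodule.span (Subring.center (unionAlgebra F π)) T,
      ∃ i ∈ I, x.1 ∈ ((π i).act (F := F)).range := by
  classical
  have := hT.to_subtype
  choose ν hν using fun S : Finset T => exists_finset_subset_range_act hπ (S.image Subtype.val)
  refine ⟨Set.range ν, Set.countable_range ν, fun x hx => ?_⟩
  obtain ⟨S, hST, hS⟩ := Submodule.mem_span_finite_of_mem_span hx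
  refine ⟨_, ⟨S.subtype (· ∈ T), rfl⟩, ?_⟩
  clear hx
  induction hS using Submodule.span_induction with
  | mem a ha =>
    exact hν _ a (Finset.mem_image.mpr ⟨⟨a, hST ha⟩, Finset.mem_subtype.mpr ha, rfl⟩)
  | zero => exact zero_mem _
  | add a b _ _ ha hb => exact add_mem ha hb
  | smul z a _ ha =>
    obtain ⟨c, hc⟩ := (isLocallyMatrix_unionAlgebra (F := F) hπ).mem_center_iff.mp z.2
    have : (z • a).1 = c • a.1 := by
      rw [Subring.smul_def, ← hc]
      change (algebraMap F _ c * a).1 = _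
      rw [← Algebra.smul_def]
      rfl
    rw [this]
    exact Subalgebra.smul_mem _ ha c

/-- The multiplication operators by the indicator functions of the fibres of the separating
functionals are countably many. An operator commuting with them preserves the `V`-coordinate, so it
commutes with multiplication by any function of that coordinate. The bicentralizer therefore
contains uncountably many multiplication operators, one for each functional, while a matrix algebra
of the system contains those of the compatible functionals only, which are finitely many. -/
theorem not_countableBicentralizers {π : ι → FiniteRetraction G}
    (hπ : ∀ i j, ∃ k, π i ≤ π k ∧ π j ≤ π k) {p : ℕ} [Fact p.Prime] (ρ : RetractionSystem p V κ) :
    ¬ CountableBicentralizers (unionAlgebra F (prodFamily π ρ.ret)) := by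
  classical
  have hdir := prodFamily_directed hπ ρ.directed
  let σ := prodFamily π ρ.ret
  -- the indicator functions of the fibres of a functional
  let χ : (V →+ ZMod p) → ZMod p → G × V → F := fun w c x => if w x.2 = c then 1 else 0
  have hmem : ∀ w ∈ ρ.functionals, ∀ c, mulOp (χ w c) ∈ unionAlgebra F σ := by
    intro w hw c
    obtain ⟨i, hi⟩ := ρ.exists_compatible w hw
    refine (mem_unionAlgebra_iff hdir).mpr ⟨(Classical.arbitrary ι, i), ?_⟩
    refine mulOp_mem_range _ _ fun x => ?_
    change (if w ((ρ.ret i).toHom x.2) = c then (1 : F) else 0) = _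
    rw [hi]
  have := ρ.countable_separating.to_subtype
  let S : Set (unionAlgebra F σ) := Set.range fun wc : ρ.separating × ZMod p =>
    ⟨mulOp (χ wc.1 wc.2), hmem _ (ρ.separating_subset wc.1.2) _⟩
  have hS : S.Countable := Set.countable_range _
  intro hCB
  obtain ⟨T, hT, hspan⟩ := hCB S hS
  obtain ⟨I, hI, hTI⟩ := exists_countable_index hdir hT
  refine ρ.uncountable
    ((hI.biUnion fun i _ => (ρ.finite_compatible i.2).countable).mono fun w hw => ?_)
  have hcent : (⟨_, hmem w hw 0⟩ : unionAlgebra F σ) ∈ S.centralizer.centralizer := by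
    rw [Set.mem_centralizer_iff]
    intro y hy
    obtain ⟨j, m, hm⟩ := (mem_unionAlgebra_iff hdir).mp y.2
    replace hm : (σ j).act m = y.1 := hm
    have hcomm : ∀ w ∈ ρ.separating, ∀ c, Commute ((σ j).act m) (mulOp (χ w c)) := by
      intro w' hw' c
      have := Set.mem_centralizer_iff.mp hy ⟨_, hmem w' (ρ.separating_subset hw') c⟩
        ⟨(⟨w', hw'⟩, c), rfl⟩
      rw [hm]
      exact (congrArg Subtype.val this).symm
    apply Subtype.ext
    change y.1 * mulOp (χ w 0) = mulOp (χ w 0) * y.1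
    rw [← hm]
    refine ((σ j).commute_act_mulOp_iff m (χ w 0)).mpr fun x b hb => ?_
    have heq : (x - (σ j).toHom x + b.1).2 = x.2 := ρ.eq_of_separating _ _ fun w' hw' => by
      have := ((σ j).commute_act_mulOp_iff m (χ w' (w' x.2))).mp (hcomm w' hw' _) x b hb
      by_contra hne
      simp only [χ, if_pos, if_neg hne] at this
      exact zero_ne_one this
    simp only [χ, heq]
  obtain ⟨i, hi, h⟩ := hTI _ (hspan _ hcent)
  refine Set.mem_biUnion hi ⟨hw, fun v => ?_⟩
  -- operators in the image of `σ i` commute with translations along its kernel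
  obtain ⟨m, hm⟩ := h
  replace hm : (σ i).act m = mulOp (χ w 0) := hm
  have h0 : (σ i).toHom (0, v - (ρ.ret i.2).toHom v) = 0 := by
    refine Prod.ext (map_zero (π i.1).toHom) ?_
    change (ρ.ret i.2).toHom (v - (ρ.ret i.2).toHom v) = 0
    rw [map_sub, (ρ.ret i.2).idem, sub_self]
  have key := act_translate m 1 h0 0
  change (σ i).act m 1 0 = _ at key
  rw [hm, mulOp_apply, mulOp_apply, Pi.one_apply, Pi.one_apply, mul_one, mul_one, zero_add] at key
  have h1 : χ w 0 0 = 1 := if_pos (map_zero w)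
  rw [h1] at key
  by_contra hne
  refine one_ne_zero (key.trans (if_neg fun h => hne ?_))
  rw [map_sub, sub_eq_zero] at h
  exact h.symm

end LargeBicentralizers

/-- Both algebras are built from coordinate retractions of a product of finite cyclic groups; the
second one has a retraction system of exponent `p` as an additional factor, which the exponent `∞`
of `s` at `p` absorbs. -/
theorem exists_not_moritaEquivalent (F : Type u) [Field F] {s : SteinitzNumber}
    (hs : ¬ s.IsLocallyFinite) {α : Cardinal.{u}} (hα : Cardinal.aleph0 < α) :
    ∃ A B : AlgCat.{u} F, IsLocallyMatrix F A ∧ IsLocallyMatrix F B ∧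
      Module.rank F A = α ∧ Module.rank F B = α ∧ steinitz F A = s ∧ steinitz F B = s ∧
      ¬ MoritaEquivalent A B := by
  classical
  obtain ⟨p, hp⟩ := not_forall_not.mp hs
  obtain ⟨β, rfl⟩ : ∃ β, α = Cardinal.mk β := ⟨_, (Cardinal.mk_out α).symm⟩
  have : Fact (p : ℕ).Prime := ⟨p.2⟩
  obtain ⟨V, κ, _, ρ, _, hκ⟩ := exists_retractionSystem (p : ℕ) hα
  let n := primeFamily s p β
  let ι := (Nat.Primes × ℕ) ⊕ β
  let π : Finset ι → FiniteRetraction (∀ i, ZMod (n i)) := FiniteRetraction.coord n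
  let σ := prodFamily π ρ.ret
  have hπ := FiniteRetraction.coord_directed (n := n)
  have hσ := prodFamily_directed hπ ρ.directed
  have hι : Cardinal.mk ι ≤ Cardinal.mk β := by
    rw [Cardinal.mk_sum, Cardinal.lift_id'.{0, u}]
    refine Cardinal.add_le_of_le hα.le (le_trans ?_ hα.le) le_rfl
    simp
  have : Infinite ι := inferInstance
  have hι' : Cardinal.mk (Finset ι) ≤ Cardinal.mk β :=
    (Cardinal.mk_finset_of_infinite ι).trans_le hι
  -- the multiplication operators by the indicator functions of the coordinate hyperplanes
  let h : β → (∀ i, ZMod (n i)) → F := fun b x => if x (.inr b) = 0 then 1 else 0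
  let g : β → (∀ i, ZMod (n i)) := fun b i => if i = .inr b then 0 else 1
  have hmem : ∀ b, mulOp (h b) ∈ ((π {.inr b}).act (F := F)).range := fun b =>
    FiniteRetraction.mulOp_mem_range _ _ fun x => by
      have : (π {.inr b}).toHom x (.inr b) = x (.inr b) := by
        simp [π, FiniteRetraction.coord_apply]
      simp only [h, this]
  have hg : ∀ b c, h b (g c) = if b = c then 1 else 0 := fun b c => by
    have : (1 : ZMod (n (.inr b))) ≠ 0 := one_ne_zero (α := ZMod p)
    by_cases hbc : b = c
    · simp [h, g, hbc]
    · simp [h, g, hbc, this]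
  refine ⟨AlgCat.of F (unionAlgebra F π), AlgCat.of F (unionAlgebra F σ),
    isLocallyMatrix_unionAlgebra hπ, isLocallyMatrix_unionAlgebra hσ,
    le_antisymm (rank_unionAlgebra_le hπ hα.le hι') ?_,
    le_antisymm (rank_unionAlgebra_le hσ hα.le ?_) ?_,
    steinitz_unionAlgebra_eq hπ hp (fun K => ⟨K, 0, ?_⟩) (fun K => ⟨K, ?_⟩),
    steinitz_unionAlgebra_eq hσ hp (fun i => ?_) (fun K => ⟨(K, Classical.arbitrary κ), ?_⟩),
    fun hM => not_countableBicentralizers hπ ρ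
      ((countableBicentralizers_coord F n).of_moritaEquivalent hM)⟩
  · exact le_rank_unionAlgebra h g (fun b => (mem_unionAlgebra_iff hπ).mpr ⟨_, hmem b⟩) hg
  · rw [Cardinal.mk_prod, Cardinal.lift_id, Cardinal.lift_id]
    exact (mul_le_mul' hι' hκ).trans (Cardinal.mul_eq_self hα.le).le
  · refine le_rank_unionAlgebra (fun b x => h b x.1) (fun b => (g b, 0))
      (fun b => (mem_unionAlgebra_iff hσ).mpr ⟨({.inr b}, Classical.arbitrary κ), ?_⟩) hg
    refine FiniteRetraction.mulOp_mem_range _ _ fun x => ?_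
    have : (π {.inr b}).toHom x.1 (.inr b) = x.1 (.inr b) := by
      simp [π, FiniteRetraction.coord_apply]
    change h b ((π {.inr b}).toHom x.1) = _
    simp only [h, this]
  · rw [FiniteRetraction.card_coord, pow_zero, mul_one]
  · rw [FiniteRetraction.card_coord]
  · obtain ⟨k, hk⟩ := ρ.card_pt i.2
    exact ⟨i.1, k, by
      rw [← hk, ← FiniteRetraction.card_coord]
      exact FiniteRetraction.card_prod _ _⟩
  · rw [← FiniteRetraction.card_coord]
    exact ⟨_, FiniteRetraction.card_prod _ _⟩

theorem theorem3p3 (F : Type u) [Field F] :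
    -- (1) Morita equivalent algebras have rationally connected Steinitz numbers
    (∀ (A B : Type u) [Ring A] [Ring B] [Algebra F A] [Algebra F B],
      IsLocallyMatrix F A → IsLocallyMatrix F B → MoritaEquivalent A B →
        (steinitz F A).RationallyConnected (steinitz F B)) ∧
    -- (2) the criterion in countable dimension, for plain and for `F`-linear equivalences
    (∀ (A B : Type u) [Ring A] [Ring B] [Algebra F A] [Algebra F B],
      IsLocallyMatrix F A → IsLocallyMatrix F B →
      Module.rank F A ≤ Cardinal.aleph0 → Module.rank F B ≤ Cardinal.aleph0 →
        (MoritaEquivalent A B ↔ (steinitz F A).RationallyConnected (steinitz F B)) ∧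
        (IsMoritaEquivalent F A B ↔ (steinitz F A).RationallyConnected (steinitz F B))) ∧
    -- (3) the criterion fails in every uncountable dimension
    (∀ s : SteinitzNumber, ¬ s.IsLocallyFinite →
      ∀ α : Cardinal.{u}, Cardinal.aleph0 < α →
        ∃ A B : AlgCat.{u} F,
          IsLocallyMatrix F A ∧ IsLocallyMatrix F B ∧
          Module.rank F A = α ∧ Module.rank F B = α ∧
          steinitz F A = s ∧ steinitz F B = s ∧
          ¬ MoritaEquivalent A B) ∧
    -- (4) countability up to isomorphism, for algebras of countable dimension
    (∀ (A : Type u) [Ring A] [Algebra F A],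
      IsLocallyMatrix F A → Module.rank F A ≤ Cardinal.aleph0 →
        ∃ C : ℕ → AlgCat.{u} F, (∀ n, InMoritaClass F A (C n)) ∧
          ∀ (B : Type u) [Ring B] [Algebra F B], InMoritaClass F A B →
            ∃ n, Nonempty (B ≃ₐ[F] C n)) ∧
    -- and countability up to universal equivalence, for algebras of any dimension
    (∀ (A : Type u) [Ring A] [Algebra F A],
      IsLocallyMatrix F A →
        ∃ C : ℕ → AlgCat.{u} F, (∀ n, InMoritaClass F A (C n)) ∧
          ∀ (B : Type u) [Ring B] [Algebra F B], InMoritaClass F A B →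
            ∃ n, UniversallyEquivalent F B (C n)) := by
  refine ⟨fun A B _ _ _ _ hA hB h => (h.invariants hA hB).1,
    fun A B _ _ _ _ hA hB hA' hB' => ⟨⟨fun h => (h.invariants hA hB).1, fun h =>
      (hA.isMoritaEquivalent hB hA' hB' h).moritaEquivalent⟩,
      fun h => (h.invariants hA).2.1, hA.isMoritaEquivalent hB hA' hB'⟩,
    fun s hs α hα => exists_not_moritaEquivalent F hs hα, fun A _ _ hA hA' => ?_,
    fun A _ _ hA => ?_⟩
  · obtain ⟨C, hC, hCB⟩ := hA.exists_seq_steinitz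
    refine ⟨C, hC, fun B _ _ hB => ?_⟩
    obtain ⟨n, hn⟩ := hCB B hB
    have hBi := hB.invariants hA
    have hCi := (hC n).invariants hA
    exact ⟨n, hBi.1.nonempty_algEquiv hCi.1 hn (hBi.2.2 hA') (hCi.2.2 hA')⟩
  · obtain ⟨C, hC, hCB⟩ := hA.exists_seq_steinitz
    refine ⟨C, hC, fun B _ _ hB => ?_⟩
    obtain ⟨n, hn⟩ := hCB B hB
    exact ⟨n, (hB.invariants hA).1.universallyEquivalent ((hC n).invariants hA).1 hn⟩
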